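/- Let $N\ge 1$, $L>0$ and $M>1$, let $Q'=(0,1)^{N-1}$, and for an $L$-Lipschitz function $f:Q'\to[1,M]$ (extended by continuity to $[0,1]^{N-1}$) set \[ Q_f=\{x=(x',x_N)\in\mathbb{R}^N : 0\le x_i\le 1 \text{ for } i=1,\dots,N-1,\ 0\le x_N\le f(x')\}. \] Identify $Q'$ with the base $Q'\times\{0\}$ of $Q_f$. For $\mathbf u\in H^1(Q_f;\mathbb{R}^N)$ let $e(\mathbf u)=\tfrac12(\nabla \mathbf u+\nabla \mathbf u^T)$, with the Frobenius norm on matrices. Then there exists a constant $C>0$, depending only on $L$ and $M$ (and on the dimension $N$, which is fixed), such that for every such $f$: (i) for any $u\in H^1(Q_f)$ with $u=0$ on $Q'$ (in the sense of traces), $\|u\|_{L^2(Q_f)}\le C\|\nabla u\|_{L^2(Q_f)}$; (ii) for any $u\in H^1(Q_f)$ with $\int_{Q_f}u\,dx=0$, $\|u\|_{L^2(Q_f)}\le C\|\nabla u\|_{L^2(Q_f)}$; (iii) for any $\mathbf u\in H^1(Q_f;\mathbb{R}^N)$ with $\mathbf u=0$ on $Q'$ (in the sense of traces), $\|\mathbf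 u\|_{L^2(Q_f)}\le C\|e(\mathbf u)\|_{L^2(Q_f)}$; (iv) for any $\mathbf u\in H^1(Q_f;\mathbb{R}^N)$ with $\int_{Q_f}\mathbf u\,dx=0$ and $\int_{Q_f}(x_i\mathbf u_j-x_j\mathbf u_i)\,dx=0$ for all $i,j=1,\dots,N$ (that is, $\mathbf u$ is $L^2$-orthogonal to the rigid motions $x\mapsto \mathbf a+Bx$ with $B$ skew-symmetric), $\|\mathbf u\|_{L^2(Q_f)}\le C\|e(\mathbf u)\|_{L^2(Q_f)}$. -/

import Mathlib

open MeasureTheory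
open scoped NNReal ENNReal ContDiff

noncomputable section

namespace PoincareKorn

/-- Euclidean space `ℝⁿ`. -/
abbrev E (n : ℕ) : Type := EuclideanSpace ℝ (Fin n)

/-- The horizontal part `x' = (x₁, …, x_d)` of a point `x = (x', x_N)` of `ℝᴺ`, `N = d + 1`. -/
def horiz {d : ℕ} (x : E (d + 1)) : E d :=
  WithLp.toLp 2 (fun i : Fin d => x i.castSucc)

/-- The point `(y, 0)` of `ℝᴺ`, for `y ∈ ℝᵈ`, `N = d + 1`. -/
def basePoint {d : ℕ} (y : E d) : E (d + 1) :=
  WithLp.toLp 2 (Fin.snoc (α := fun _ => ℝ) (fun i : Fin d => y i) 0)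

/-- The open unit cube `Q' = (0,1)ᵈ`. -/
def openCube (d : ℕ) : Set (E d) := {y | ∀ i, 0 < y i ∧ y i < 1}

/-- The domain `Q_f = {x = (x', x_N) : 0 ≤ x_i ≤ 1 for i < N, 0 ≤ x_N ≤ f(x')}`. -/
def Q {d : ℕ} (f : E d → ℝ) : Set (E (d + 1)) :=
  {x | (∀ i : Fin d, 0 ≤ x i.castSucc ∧ x i.castSucc ≤ 1) ∧
    0 ≤ x (Fin.last d) ∧ x (Fin.last d) ≤ f (horiz x)}

/-- The partial derivative `∂ᵢφ` of a smooth function. -/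
def partialDeriv {n : ℕ} (i : Fin n) (φ : E n → ℝ) (x : E n) : ℝ :=
  fderiv ℝ φ x (EuclideanSpace.single i 1)

/-- `φ ∈ C_c^∞(U)`. -/
def IsTestFunction {n : ℕ} (U : Set (E n)) (φ : E n → ℝ) : Prop :=
  ContDiff ℝ ∞ φ ∧ HasCompactSupport φ ∧ tsupport φ ⊆ U

/-- `u ∈ H¹(S)` with weak gradient `∇u = g`: both `u` and `g` are in `L²(S)`, and
`∫ u ∂ᵢφ = -∫ gᵢ φ` for all `i` and all `φ ∈ C_c^∞(interior S)`. -/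
def IsH1 {n : ℕ} (S : Set (E n)) (u : E n → ℝ) (g : E n → E n) : Prop :=
  MemLp u 2 (volume.restrict S) ∧ MemLp g 2 (volume.restrict S) ∧
    ∀ φ : E n → ℝ, IsTestFunction (interior S) φ → ∀ i : Fin n,
      ∫ x in S, u x * partialDeriv i φ x = -∫ x in S, g x i * φ x

/-- `u ∈ H¹(S; ℝⁿ)`, where `G i` is the weak gradient of the component `uᵢ`. -/
def IsH1Vec {n : ℕ} (S : Set (E n)) (u : E n → E n) (G : Fin n → E n → E n) : Prop :=
  ∀ i : Fin n, IsH1 S (fun x => u x i) (G i)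

/-- The symmetrized gradient `e(u)ᵢⱼ = (∂ⱼuᵢ + ∂ᵢuⱼ)/2`, where `G i = ∇uᵢ`. Its values lie in
`ℝ^{n×n}` with the Euclidean (that is, Frobenius) norm. -/
def symGrad {n : ℕ} (G : Fin n → E n → E n) (x : E n) : EuclideanSpace ℝ (Fin n × Fin n) :=
  WithLp.toLp 2 (fun p : Fin n × Fin n => (G p.1 x p.2 + G p.2 x p.1) / 2)

/-- A function `u ∈ H¹(Q_f)` with weak gradient `g` has the trace `w ∈ L²(Q')` on the base
`Q' × {0}` of `Q_f`. The trace is the function in Green's formula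
`∫_{Q_f} u ∂_Nφ = -∫_{Q_f} (∂_N u) φ - ∫_{Q'} w φ(·, 0)` (the outer normal on the base is `-e_N`),
which determines `w` almost everywhere on `Q'`. The test functions vanish near the rest of the
boundary, but not on the base. -/
def HasBaseTrace {d : ℕ} (f : E d → ℝ) (u : E (d + 1) → ℝ) (g : E (d + 1) → E (d + 1))
    (w : E d → ℝ) : Prop :=
  MemLp w 2 (volume.restrict (openCube d)) ∧
    ∀ φ : E (d + 1) → ℝ,
      IsTestFunction {x | horiz x ∈ openCube d ∧ x (Fin.last d) < f (horiz x)} φ →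
        ∫ x in Q f, u x * partialDeriv (Fin.last d) φ x =
          -(∫ x in Q f, g x (Fin.last d) * φ x) - ∫ y in openCube d, w y * φ (basePoint y)

end PoincareKorn

end

namespace PoincareKorn

/-! ### Translates and directional derivatives: the L² difference estimate by duality. -/

section Translation

variable {n : ℕ}

/-! Everything follows from translating by explicit vectors; no compactness enters, so the constants
depend on `d`, `L` and `M` only. If `w` has the weak derivative `k` in the direction `v` along the
segments from `A` to `A + v`, then the L² norm of `w(· + v) - w` on `A` is at most that of `k`. For
a scalar function `k = v · ∇u`. For a vector field this is applied to `v · U`, whose derivative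
along `v` is `v ⊗ v : e(U)`, so only the symmetrized gradient appears
(`lintegral_inner_translate_sub_le`).

Such estimates transport bounds through the domain. Since `f` is `L`-Lipschitz, a displacement with
horizontal part `z` and descent `h ≥ L ‖z‖` keeps a point below the graph. One descending vector
suffices for a scalar; for a field, `d + 1` independent descending vectors recover all components of
`U` from the longitudinal ones (`lintegral_le_of_downVec`). The horizontal steps must stay in the
cube, whence the finite splitting into sectors.

With zero trace on the base, the extension by zero is weakly differentiable below the graph.
Descending by `M` takes every point below the base, where the extension vanishes, and this gives (i)
and (iii).

For (ii) and (iv), every `Q_f` contains the unit cube, because `f ≥ 1`. On the cube, integrating the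
translation estimate over all `v` bounds a double integral in `x` and `y`. Averaging in `y` shows
that a function is close to a constant (`exists_const_approx`), and a field to a rigid motion
(`exists_rigidMap_approx`). In the second case the average is taken against weights dual to the
coordinates, and a second average controls the symmetric part of the resulting affine map. Constants
and rigid motions do not change the differences concerned, so the approximation spreads from the
cube to `Q_f` through slabs. Orthogonality then bounds `u` itself by its distance to the
approximant. -/

lemma abs_integral_mul_le {α : Type*} [MeasurableSpace α] {μ : Measure α} {f g : α → ℝ}
    (hf : MemLp f 2 μ) (hg : MemLp g 2 μ) :
    |∫ x, f x * g x ∂μ| ≤ (eLpNorm f 2 μ).toReal * (eLpNorm g 2 μ).toReal := by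
  have h := abs_real_inner_le_norm (hf.toLp f) (hg.toLp g)
  rw [L2.inner_def, Lp.norm_toLp, Lp.norm_toLp] at h
  refine le_trans (le_of_eq ?_) h
  congr 1
  apply integral_congr_ae
  filter_upwards [hf.coeFn_toLp, hg.coeFn_toLp] with x h1 h2
  simp [h1, h2, mul_comm]

lemma IsTestFunction.memLp {U : Set (E n)} {φ : E n → ℝ} (h : IsTestFunction U φ) {p : ℝ≥0∞}
    (μ : Measure (E n)) [IsFiniteMeasureOnCompacts μ] : MemLp φ p μ :=
  h.1.continuous.memLp_of_hasCompactSupport h.2.1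

lemma IsTestFunction.zero {U : Set (E n)} : IsTestFunction U (0 : E n → ℝ) :=
  ⟨contDiff_const, HasCompactSupport.zero, by simp [tsupport]⟩

lemma IsTestFunction.add {U : Set (E n)} {φ ψ : E n → ℝ} (h : IsTestFunction U φ)
    (h' : IsTestFunction U ψ) : IsTestFunction U (φ + ψ) :=
  ⟨h.1.add h'.1, h.2.1.add h'.2.1, (tsupport_add φ ψ).trans (Set.union_subset h.2.2 h'.2.2)⟩

lemma IsTestFunction.smul {U : Set (E n)} {φ : E n → ℝ} (h : IsTestFunction U φ)
    (c : ℝ) : IsTestFunction U (c • φ) :=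
  ⟨h.1.const_smul c, h.2.1.mono (Function.support_const_smul_subset c φ),
    (closure_mono (Function.support_const_smul_subset c φ)).trans h.2.2⟩

lemma IsTestFunction.mono {U V : Set (E n)} {φ : E n → ℝ} (h : IsTestFunction U φ)
    (hUV : U ⊆ V) : IsTestFunction V φ :=
  ⟨h.1, h.2.1, h.2.2.trans hUV⟩

/-- The `L²` classes of test functions on `A`. -/
def testSubmodule (A : Set (E n)) : Submodule ℝ (Lp ℝ 2 (volume.restrict A)) where
  carrier := {F | ∃ φ : E n → ℝ, IsTestFunction A φ ∧ F =ᵐ[volume.restrict A] φ}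
  zero_mem' := ⟨0, .zero, Lp.coeFn_zero _ _ _⟩
  add_mem' := by
    rintro F G ⟨φ, hφ, hF⟩ ⟨ψ, hψ, hG⟩
    exact ⟨φ + ψ, hφ.add hψ, (Lp.coeFn_add F G).trans (hF.add hG)⟩
  smul_mem' := by
    rintro c F ⟨φ, hφ, hF⟩
    exact ⟨c • φ, hφ.smul c, (Lp.coeFn_smul c F).trans (hF.const_smul c)⟩

/-- The orthogonal complement is trivial by the fundamental lemma of the calculus of variations. -/
lemma testSubmodule_topologicalClosure {A : Set (E n)} (hA : IsOpen A) :
    (testSubmodule A).topologicalClosure = ⊤ := by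
  rw [Submodule.topologicalClosure_eq_top_iff, Submodule.eq_bot_iff]
  intro F hF
  rw [Submodule.mem_orthogonal] at hF
  rw [Lp.eq_zero_iff_ae_eq_zero, Filter.EventuallyEq, ae_restrict_iff' hA.measurableSet]
  have hloc : LocallyIntegrableOn F A := by
    exact locallyIntegrableOn_of_locallyIntegrable_restrict
      ((Lp.memLp F).locallyIntegrable (by norm_num))
  refine IsOpen.ae_eq_zero_of_integral_contDiff_smul_eq_zero hA hloc ?_
  intro φ h1 h2 h3
  have hφ : IsTestFunction A φ := ⟨h1, h2, h3⟩
  have hm := hφ.memLp (p := 2) (volume.restrict A)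
  have := hF (hm.toLp φ) ⟨φ, hφ, hm.coeFn_toLp⟩
  rw [L2.inner_def] at this
  rw [← setIntegral_eq_integral_of_forall_compl_eq_zero (s := A), ← this]
  · apply integral_congr_ae
    filter_upwards [hm.coeFn_toLp] with x hx
    simp [hx, mul_comm]
  · intro x hx
    rw [image_eq_zero_of_notMem_tsupport (fun h => hx (h3 h)), zero_smul]

/-- Density extends the bound on the pairing from test functions to all of L²; pairing `h` with
itself then gives the norm bound. -/
lemma eLpNorm_le_of_forall_test {A : Set (E n)} (hA : IsOpen A) {h : E n → ℝ}
    (hh : MemLp h 2 (volume.restrict A)) {c : ℝ} (hc : 0 ≤ c)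
    (H : ∀ φ, IsTestFunction A φ →
      |∫ x in A, h x * φ x| ≤ c * (eLpNorm φ 2 volume).toReal) :
    eLpNorm h 2 (volume.restrict A) ≤ ENNReal.ofReal c := by
  have key : ∀ F : Lp ℝ 2 (volume.restrict A), |inner ℝ F (hh.toLp h)| ≤ c * ‖F‖ := by
    intro F
    have hF : F ∈ closure (testSubmodule A : Set (Lp ℝ 2 (volume.restrict A))) := by
      rw [← Submodule.topologicalClosure_coe, testSubmodule_topologicalClosure hA]; trivial
    refine closure_minimal (s := (testSubmodule A : Set (Lp ℝ 2 (volume.restrict A))))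
      (t := {F | |inner ℝ F (hh.toLp h)| ≤ c * ‖F‖}) ?_ ?_ hF
    · rintro F ⟨φ, hφ, hF⟩
      have h1 := H φ hφ
      have h2 : ‖F‖ = (eLpNorm φ 2 volume).toReal := by
        rw [Lp.norm_def, eLpNorm_congr_ae hF, eLpNorm_restrict_eq_of_support_subset
          ((subset_tsupport φ).trans hφ.2.2)]
      have h3 : inner ℝ F (hh.toLp h) = ∫ x in A, h x * φ x := by
        rw [L2.inner_def]
        apply integral_congr_ae
        filter_upwards [hF, hh.coeFn_toLp] with x hx hx'
        simp [hx, hx']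
      simpa only [Set.mem_ofPred_eq, h2, h3] using h1
    · exact isClosed_le (by fun_prop) (by fun_prop)
  have h1 := key (hh.toLp h)
  rw [real_inner_self_eq_norm_sq, abs_of_nonneg (by positivity), Lp.norm_toLp] at h1
  have h2 : (eLpNorm h 2 (volume.restrict A)).toReal ≤ c := by
    by_contra! hlt
    nlinarith [hc.trans_lt hlt]
  rwa [← ENNReal.ofReal_toReal hh.2.ne, ENNReal.ofReal_le_ofReal_iff hc]

lemma IsTestFunction.translate {A Ω : Set (E n)} {φ : E n → ℝ} (h : IsTestFunction A φ)
    (z : E n) (hz : ∀ x ∈ A, x + z ∈ Ω) : IsTestFunction Ω (fun y => φ (y - z)) := by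
  refine ⟨h.1.comp (contDiff_id.sub contDiff_const),
    h.2.1.comp_homeomorph (Homeomorph.subRight z), ?_⟩
  have : tsupport (fun y => φ (y - z)) ⊆ (fun y => y - z) ⁻¹' tsupport φ :=
    tsupport_comp_subset_preimage φ (continuous_id.sub continuous_const)
  intro x hx
  simpa using hz _ (h.2.2 (this hx))

/-- Paired with a test function `φ`, the difference becomes `J 1 - J 0` with `J t = ∫ w φ(· - t v)`.
The derivative of `J` is the pairing of `k` with a translate of `φ`, which Cauchy–Schwarz bounds
uniformly in `t`. -/
lemma eLpNorm_translate_sub_le {Ω A : Set (E n)} (hA : IsOpen A) {w k : E n → ℝ}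
    (hw : Integrable w) (hw2 : MemLp w 2) (hk2 : MemLp k 2) (v : E n)
    (hwk : ∀ φ, IsTestFunction Ω φ → ∫ x, w x * fderiv ℝ φ x v = -∫ x, k x * φ x)
    (hAΩ : ∀ x ∈ A, ∀ t ∈ Set.Icc (0 : ℝ) 1, x + t • v ∈ Ω) :
    eLpNorm (fun x => w (x + v) - w x) 2 (volume.restrict A) ≤ eLpNorm k 2 volume := by
  have hwv : MemLp (fun x => w (x + v)) 2 :=
    hw2.comp_measurePreserving (measurePreserving_add_right volume v)
  have hd : MemLp (fun x => w (x + v) - w x) 2 := hwv.sub hw2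
  rw [← ENNReal.ofReal_toReal hk2.2.ne]
  refine eLpNorm_le_of_forall_test hA (hd.restrict A) ENNReal.toReal_nonneg fun φ hφ => ?_
  set J : ℝ → ℝ := fun t => ∫ y, w y * φ (y - t • v) with hJ
  have hφc : Continuous (fderiv ℝ φ) := hφ.1.continuous_fderiv (by simp)
  obtain ⟨K, hK⟩ := hφc.bounded_above_of_compact_support (hφ.2.1.fderiv ℝ)
  have hφd : Differentiable ℝ φ := hφ.1.differentiable (by simp)
  have hint : ∀ t : ℝ, Integrable (fun y => w y * φ (y - t • v)) := fun t => by
    have h2 : MemLp (fun y => φ (y - t • v)) 2 := (hφ.memLp (p := 2) volume).comp_measurePreserving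
      (measurePreserving_sub_right volume (t • v))
    exact hw2.integrable_mul h2
  have hder : ∀ t, HasDerivAt J (∫ y, w y * -(fderiv ℝ φ (y - t • v) v)) t := by
    intro t
    refine (hasDerivAt_integral_of_dominated_loc_of_deriv_le (s := Set.univ)
      (bound := fun y => ‖w y‖ * (K * ‖v‖)) (F := fun t y => w y * φ (y - t • v))
      (F' := fun t y => w y * -(fderiv ℝ φ (y - t • v) v)) Filter.univ_mem
      (Filter.Eventually.of_forall fun t => (hint t).1) (hint t) ?_ ?_
      (hw.norm.mul_const _) ?_).2
    · exact hw.1.mul (Continuous.aestronglyMeasurable (by fun_prop))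
    · refine Filter.Eventually.of_forall fun y t _ => ?_
      rw [norm_mul, norm_neg]
      gcongr
      exact (ContinuousLinearMap.le_opNorm _ _).trans (by gcongr; exact hK _)
    · refine Filter.Eventually.of_forall fun y t _ => ?_
      have h1 : HasDerivAt (fun t : ℝ => y - t • v) (-v) t := by
        simpa using ((hasDerivAt_id t).smul_const v).const_sub y
      have h2 := (hφd (y - t • v)).hasFDerivAt.comp_hasDerivAt t h1
      simpa using h2.const_mul (w y)
  -- The segment hypothesis is used here: it makes `φ(· - t v)` admissible on `Ω`, so the derivative
  -- can be moved onto `w`.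
  have hval : ∀ t ∈ Set.Icc (0 : ℝ) 1, (∫ y, w y * -(fderiv ℝ φ (y - t • v) v)) =
      ∫ y, k y * φ (y - t • v) := by
    intro t ht
    have h1 := hwk _ (hφ.translate (t • v) fun x hx => hAΩ x hx t ht)
    simp only [fderiv_comp_sub] at h1
    simp only [mul_neg, integral_neg, h1, neg_neg]
  have hJ1 := norm_image_sub_le_of_norm_deriv_le_segment_01' (f := J)
    (C := (eLpNorm k 2 volume).toReal * (eLpNorm φ 2 volume).toReal)
    (fun t _ => (hder t).hasDerivWithinAt) (fun t ht => by
      rw [hval t ⟨ht.1, ht.2.le⟩, Real.norm_eq_abs]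
      have hmp := measurePreserving_sub_right (volume : Measure (E n)) (t • v)
      have h2 : MemLp (fun y => φ (y - t • v)) 2 :=
        (hφ.memLp (p := 2) volume).comp_measurePreserving hmp
      refine (abs_integral_mul_le hk2 h2).trans (le_of_eq ?_)
      rw [← eLpNorm_comp_measurePreserving (g := φ) (hφ.memLp (p := 2) volume).1 hmp]
      rfl)
  refine le_trans (le_of_eq ?_) hJ1
  rw [Real.norm_eq_abs]
  congr 1
  have hφ2 := hφ.memLp (p := 2) volume
  rw [setIntegral_eq_integral_of_forall_compl_eq_zero (s := A)]
  · have h1 : (∫ y, w y * φ (y - v)) = ∫ x, w (x + v) * φ x := by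
      rw [← integral_add_right_eq_self _ v]; simp
    simp only [hJ, one_smul, zero_smul, sub_zero, h1, sub_mul]
    exact integral_sub (hwv.integrable_mul hφ2) (hw2.integrable_mul hφ2)
  · intro x hx
    rw [image_eq_zero_of_notMem_tsupport (fun h => hx (hφ.2.2 h)), mul_zero]

end Translation

/-! ### Geometry of `Q_f`: openness, null boundary, boundedness. -/

section Domain

variable {d : ℕ}

/-- The open cylinder over `Q'` below the graph of `f`. -/
def belowGraph (f : E d → ℝ) : Set (E (d + 1)) :=
  {x | horiz x ∈ openCube d ∧ x (Fin.last d) < f (horiz x)}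

/-- The part of `Q_f` where all the defining inequalities are strict. -/
def openQ (f : E d → ℝ) : Set (E (d + 1)) :=
  {x | x ∈ belowGraph f ∧ 0 < x (Fin.last d)}

@[simp] lemma horiz_apply (x : E (d + 1)) (i : Fin d) : horiz x i = x i.castSucc := rfl

lemma horiz_add_smul (x v : E (d + 1)) (t : ℝ) : horiz (x + t • v) = horiz x + t • horiz v := by
  ext i; simp

lemma continuous_horiz : Continuous (horiz : E (d + 1) → E d) := by
  unfold horiz
  fun_prop

lemma isOpen_openCube : IsOpen (openCube d) := by
  have : openCube d = ⋂ i : Fin d, {y : E d | 0 < y i ∧ y i < 1} := by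
    ext y; simp [openCube]
  rw [this]
  refine isOpen_iInter_of_finite fun i => ?_
  have h : Continuous fun y : E d => y i := by fun_prop
  exact (isOpen_lt continuous_const h).inter (isOpen_lt h continuous_const)

variable {f : E d → ℝ}

lemma continuousOn_gap (hf : ContinuousOn f (openCube d)) :
    ContinuousOn (fun x : E (d + 1) => f (horiz x) - x (Fin.last d)) (horiz ⁻¹' openCube d) :=
  (hf.comp continuous_horiz.continuousOn fun _ hx => hx).sub (by fun_prop)

lemma isOpen_belowGraph (hf : ContinuousOn f (openCube d)) : IsOpen (belowGraph f) := by
  convert (continuousOn_gap hf).isOpen_inter_preimage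
    (isOpen_openCube.preimage continuous_horiz) (isOpen_Ioi (a := (0 : ℝ))) using 1
  ext x; simp [belowGraph]

lemma isOpen_openQ (hf : ContinuousOn f (openCube d)) : IsOpen (openQ f) := by
  have h : Continuous fun x : E (d + 1) => x (Fin.last d) := by fun_prop
  exact (isOpen_belowGraph hf).inter (isOpen_lt continuous_const h)

lemma openQ_subset_Q : openQ f ⊆ Q f :=
  fun _ hx => ⟨fun i => ⟨(hx.1.1 i).1.le, (hx.1.1 i).2.le⟩, hx.2.le, hx.1.2.le⟩

lemma openQ_subset_interior (hf : ContinuousOn f (openCube d)) : openQ f ⊆ interior (Q f) :=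
  interior_maximal openQ_subset_Q (isOpen_openQ hf)

/-- The translates by `e / (k + 1)` are pairwise disjoint with bounded shifts; infinitely many
disjoint sets of equal measure in a bounded region force measure zero. It serves for the faces of
the cube and for the graph of `f`. -/
lemma volume_eq_zero_of_line {n : ℕ} {s : Set (E n)} (hs : MeasurableSet s) (e : E n)
    (h : ∀ x ∈ s, ∀ t : ℝ, t ≠ 0 → x + t • e ∉ s) : volume s = 0 := by
  refine Measure.addHaar_eq_zero_of_disjoint_translates volume
    (fun k : ℕ => (1 / ((k : ℝ) + 1)) • e) ?_ ?_ hs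
  · refine (Metric.isBounded_closedBall (x := (0 : E n)) (r := ‖e‖)).subset ?_
    rintro _ ⟨k, rfl⟩
    rw [mem_closedBall_zero_iff, norm_smul]
    refine mul_le_of_le_one_left (norm_nonneg _) ?_
    rw [Real.norm_of_nonneg (by positivity), div_le_one (by positivity)]
    linarith [Nat.cast_nonneg (α := ℝ) k]
  · intro j k hjk
    rw [Function.onFun, Set.disjoint_left]
    rintro _ ⟨_, rfl, x, hx, rfl⟩ ⟨_, rfl, y, hy, hxy⟩
    refine h x hx (1 / ((j : ℝ) + 1) - 1 / ((k : ℝ) + 1)) ?_ ?_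
    · intro h0
      rw [sub_eq_zero, one_div, one_div, inv_inj] at h0
      exact hjk (by exact_mod_cast add_right_cancel h0)
    · convert hy using 1
      have h' : (1 / ((k : ℝ) + 1)) • e + y = (1 / ((j : ℝ) + 1)) • e + x := hxy
      rw [sub_smul, ← add_sub_assoc, add_comm x, ← h']
      abel

lemma volume_coord_eq {n : ℕ} (i : Fin n) (c : ℝ) : volume {x : E n | x i = c} = 0 := by
  refine volume_eq_zero_of_line (isClosed_eq (by fun_prop) (by fun_prop)).measurableSet
    (EuclideanSpace.single i 1) fun x hx t ht h => ht ?_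
  simp only [Set.mem_ofPred_eq] at hx h
  simpa [hx] using h

lemma volume_graph (hf : ContinuousOn f (openCube d)) :
    volume {x : E (d + 1) | horiz x ∈ openCube d ∧ x (Fin.last d) = f (horiz x)} = 0 := by
  have hU := isOpen_openCube.preimage (continuous_horiz (d := d))
  refine volume_eq_zero_of_line ?_ (EuclideanSpace.single (Fin.last d) 1) ?_
  · convert hU.measurableSet.diff ((continuousOn_gap hf).isOpen_inter_preimage hU
      (isOpen_compl_singleton (x := (0 : ℝ)))).measurableSet using 1
    ext x
    simp only [Set.mem_ofPred_eq, Set.mem_sdiff, Set.mem_preimage, Set.mem_inter_iff,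
      Set.mem_compl_iff, Set.mem_singleton_iff, sub_eq_zero]
    tauto
  · rintro x ⟨-, hx⟩ t ht ⟨-, h⟩
    have : horiz (x + t • EuclideanSpace.single (Fin.last d) (1 : ℝ)) = horiz x := by
      ext i; simp [(Fin.castSucc_lt_last i).ne]
    rw [this, ← hx] at h
    exact ht (by simpa using h)

/-- The difference lies in finitely many coordinate hyperplanes and the graph over the open cube.
Hence values of `f` outside the open cube never matter. -/
lemma openQ_ae_eq (hf : ContinuousOn f (openCube d)) : openQ f =ᵐ[volume] Q f := by
  refine (LE.le.eventuallyLE openQ_subset_Q).antisymm ?_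
  have h1 : ∀ᵐ x : E (d + 1), ∀ i, x i ≠ 0 ∧ x i ≠ 1 := by
    rw [ae_all_iff]
    intro i
    exact (measure_eq_zero_iff_ae_notMem.1 (volume_coord_eq i 0)).and
      (measure_eq_zero_iff_ae_notMem.1 (volume_coord_eq i 1))
  filter_upwards [h1, measure_eq_zero_iff_ae_notMem.1 (volume_graph hf)] with x hx hx' hQ
  have hc : horiz x ∈ openCube d := fun i =>
    ⟨(hQ.1 i).1.lt_of_ne (hx _).1.symm, (hQ.1 i).2.lt_of_ne (hx _).2⟩
  exact ⟨⟨hc, hQ.2.2.lt_of_ne fun h => hx' ⟨hc, h⟩⟩, hQ.2.1.lt_of_ne (hx _).1.symm⟩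

lemma norm_le_of_forall_abs_le {n : ℕ} {x : E n} {M : ℝ} (h : ∀ i, |x i| ≤ M) :
    ‖x‖ ≤ n * M := by
  rw [← (EuclideanSpace.basisFun (Fin n) ℝ).sum_repr x]
  refine (norm_sum_le _ _).trans ((Finset.sum_le_card_nsmul _ _ M fun i _ => ?_).trans ?_)
  · simpa [norm_smul] using h i
  · simp

lemma abs_coord_le_of_mem_openQ {M : ℝ} (hM : 1 ≤ M) (hfM : ∀ y ∈ openCube d, f y ≤ M)
    {x : E (d + 1)} (hx : x ∈ openQ f) (i : Fin (d + 1)) : |x i| ≤ M := by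
  refine Fin.lastCases ?_ (fun j => ?_) i
  · rw [abs_of_pos hx.2]
    exact hx.1.2.le.trans (hfM _ hx.1.1)
  · have := hx.1.1 j
    rw [horiz_apply] at this
    rw [abs_of_pos this.1]
    exact this.2.le.trans hM

lemma volume_openQ_lt_top {M : ℝ} (hM : 1 ≤ M) (hfM : ∀ y ∈ openCube d, f y ≤ M) :
    volume (openQ f) < ⊤ := by
  refine (measure_mono fun x hx => ?_).trans_lt
    (measure_closedBall_lt_top (x := (0 : E (d + 1))) (r := (d + 1 : ℕ) * M))
  rw [mem_closedBall_zero_iff]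
  exact norm_le_of_forall_abs_le (abs_coord_le_of_mem_openQ hM hfM hx)

end Domain

/-! ### Extension by zero to globally defined functions. -/

section Extension

lemma sq_eLpNorm_two {α F : Type*} [MeasurableSpace α] [NormedAddCommGroup F] {μ : Measure α}
    (f : α → F) : eLpNorm f 2 μ ^ 2 = ∫⁻ x, ‖f x‖ₑ ^ 2 ∂μ := by
  have := eLpNorm_nnreal_pow_eq_lintegral (f := f) (μ := μ) (p := 2) (by norm_num)
  simpa using this

/-- Square-integrable functions on `S` are represented by global functions vanishing off an
a.e. equal measurable set `S'`. -/
lemma exists_extension {α F : Type*} [MeasurableSpace α] {μ : Measure α} [NormedAddCommGroup F]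
    {S S' : Set α} (hS' : MeasurableSet S') (hSS : S' =ᵐ[μ] S) (hfin : μ S' < ⊤) {u : α → F}
    (hu : MemLp u 2 (μ.restrict S)) :
    ∃ w : α → F, StronglyMeasurable w ∧ MemLp w 2 μ ∧ Integrable w μ ∧ (∀ x ∉ S', w x = 0) ∧
      w =ᵐ[μ.restrict S] u := by
  rw [← Measure.restrict_congr_set hSS] at hu ⊢
  have hw : StronglyMeasurable (S'.indicator (hu.1.mk u)) := hu.1.stronglyMeasurable_mk.indicator hS'
  have he : S'.indicator (hu.1.mk u) =ᵐ[μ.restrict S'] u :=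
    (indicator_ae_eq_restrict hS').trans hu.1.ae_eq_mk.symm
  have h2 : MemLp (S'.indicator (hu.1.mk u)) 2 μ := by
    rw [memLp_indicator_iff_restrict hS']
    exact hu.ae_eq hu.1.ae_eq_mk
  refine ⟨_, hw, h2, ?_, fun x hx => Set.indicator_of_notMem hx _, he⟩
  rw [integrable_indicator_iff hS']
  have : IsFiniteMeasure (μ.restrict S') := ⟨by simpa using hfin⟩
  exact (hu.ae_eq hu.1.ae_eq_mk).integrable (by norm_num)

lemma integral_mul_extension {α : Type*} [MeasurableSpace α] {μ : Measure α}
    {S S' : Set α} (hSS : S' =ᵐ[μ] S) {u w ψ : α → ℝ}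
    (hw0 : ∀ x ∉ S', w x = 0) (hwu : w =ᵐ[μ.restrict S] u) :
    ∫ x, w x * ψ x ∂μ = ∫ x in S, u x * ψ x ∂μ := by
  rw [← setIntegral_eq_integral_of_forall_compl_eq_zero (s := S') (f := fun x => w x * ψ x)
    (fun x hx => by rw [hw0 x hx, zero_mul]), Measure.restrict_congr_set hSS]
  apply integral_congr_ae
  filter_upwards [hwu] with x hx
  rw [hx]

end Extension

/-! ### Translation estimates in terms of the gradient and the symmetrized gradient. -/

section WeakGradient

variable {n : ℕ}

/-- `g` is the weak gradient of the globally defined function `w` on the open set `Ω`. -/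
def HasWeakGrad (Ω : Set (E n)) (w : E n → ℝ) (g : E n → E n) : Prop :=
  ∀ φ : E n → ℝ, IsTestFunction Ω φ → ∀ i : Fin n,
    ∫ x, w x * partialDeriv i φ x = -∫ x, g x i * φ x

lemma fderiv_eq_sum_partialDeriv (φ : E n → ℝ) (x v : E n) :
    fderiv ℝ φ x v = ∑ i, v i * partialDeriv i φ x := by
  conv_lhs => rw [← (EuclideanSpace.basisFun (Fin n) ℝ).sum_repr v]
  simp [partialDeriv]

lemma IsTestFunction.memLp_partialDeriv {U : Set (E n)} {φ : E n → ℝ} (h : IsTestFunction U φ)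
    (i : Fin n) {p : ℝ≥0∞} (μ : Measure (E n)) [IsFiniteMeasureOnCompacts μ] :
    MemLp (partialDeriv i φ) p μ := by
  have h1 : Continuous (partialDeriv i φ) :=
    (h.1.continuous_fderiv (by simp)).clm_apply continuous_const
  exact h1.memLp_of_hasCompactSupport (h.2.1.fderiv_apply ℝ _)

lemma memLp_coord {α : Type*} [MeasurableSpace α] {μ : Measure α} {g : α → E n}
    (hg : MemLp g 2 μ) (i : Fin n) : MemLp (fun x => g x i) 2 μ :=
  (EuclideanSpace.proj i : E n →L[ℝ] ℝ).comp_memLp' hg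

lemma lintegral_translate_sub_le {Ω A : Set (E n)} (hA : IsOpen A) {w k : E n → ℝ}
    (hw : Integrable w) (hw2 : MemLp w 2) (hk2 : MemLp k 2) (v : E n)
    (hwk : ∀ φ, IsTestFunction Ω φ → ∫ x, w x * fderiv ℝ φ x v = -∫ x, k x * φ x)
    (hAΩ : ∀ x ∈ A, ∀ t ∈ Set.Icc (0 : ℝ) 1, x + t • v ∈ Ω) :
    ∫⁻ x in A, ‖w (x + v) - w x‖ₑ ^ 2 ≤ ∫⁻ x, ‖k x‖ₑ ^ 2 := by
  rw [← sq_eLpNorm_two, ← sq_eLpNorm_two]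
  gcongr
  exact eLpNorm_translate_sub_le hA hw hw2 hk2 v hwk hAΩ

lemma HasWeakGrad.lintegral_translate_sub_le {Ω A : Set (E n)} {w : E n → ℝ} {g : E n → E n}
    (h : HasWeakGrad Ω w g) (hA : IsOpen A)
    (hw : Integrable w) (hw2 : MemLp w 2) (hg2 : MemLp g 2) (v : E n)
    (hAΩ : ∀ x ∈ A, ∀ t ∈ Set.Icc (0 : ℝ) 1, x + t • v ∈ Ω) :
    ∫⁻ x in A, ‖w (x + v) - w x‖ₑ ^ 2 ≤ ‖v‖ₑ ^ 2 * ∫⁻ x, ‖g x‖ₑ ^ 2 := by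
  have hk2 : MemLp (fun x => ∑ i, v i * g x i) 2 :=
    memLp_finsetSum _ fun i _ => (memLp_coord hg2 i).const_mul _
  refine (PoincareKorn.lintegral_translate_sub_le hA hw hw2 hk2 v (fun φ hφ => ?_) hAΩ).trans ?_
  · simp only [fderiv_eq_sum_partialDeriv, Finset.mul_sum, Finset.sum_mul]
    rw [integral_finsetSum, integral_finsetSum, ← Finset.sum_neg_distrib]
    · refine Finset.sum_congr rfl fun i _ => ?_
      have := h φ hφ i
      simp only [mul_left_comm _ (v i), mul_assoc (v i), integral_const_mul, this, mul_neg]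
    · exact fun i _ => ((memLp_coord hg2 i).const_mul (v i)).integrable_mul (hφ.memLp (p := 2) volume)
    · exact fun i _ => hw2.integrable_mul ((hφ.memLp_partialDeriv i (p := 2) volume).const_mul _)
  · rw [← lintegral_const_mul' _ _ (by simp)]
    refine lintegral_mono fun x => ?_
    rw [← mul_pow]
    gcongr
    have : ∑ i, v i * g x i = inner ℝ (g x) v := by simp [PiLp.inner_apply]
    rw [this]
    simp only [← ofReal_norm]
    rw [← ENNReal.ofReal_mul (norm_nonneg _)]
    refine ENNReal.ofReal_le_ofReal ?_
    rw [mul_comm]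
    exact norm_inner_le_norm _ _

/-- The tensor `v ⊗ v`. -/
noncomputable def tensorSq (v : E n) : EuclideanSpace ℝ (Fin n × Fin n) :=
  WithLp.toLp 2 fun p => v p.1 * v p.2

lemma norm_tensorSq (v : E n) : ‖tensorSq v‖ = ‖v‖ ^ 2 := by
  rw [EuclideanSpace.norm_eq, EuclideanSpace.norm_eq, Real.sq_sqrt (by positivity),
    Real.sqrt_eq_iff_mul_self_eq (by positivity) (by positivity), Finset.sum_mul_sum,
    Fintype.sum_prod_type]
  simp [tensorSq, mul_pow]

/-- The tensor `v ⊗ v` is symmetric, so it does not see the skew part of the gradient. -/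
lemma inner_tensorSq_symGrad (v : E n) (G : Fin n → E n → E n) (x : E n) :
    inner ℝ (tensorSq v) (symGrad G x) = ∑ i, ∑ j, v i * v j * G i x j := by
  have h : ∑ i, ∑ j, v i * v j * G i x j = ∑ i, ∑ j, v i * v j * G j x i := by
    rw [Finset.sum_comm]
    simp only [mul_comm (v _) (v _)]
  have h2 : ∑ i, ∑ j, v i * v j * G i x j =
      (∑ i, ∑ j, v i * v j * G i x j + ∑ i, ∑ j, v i * v j * G j x i) / 2 := by linarith
  rw [h2, PiLp.inner_apply, Fintype.sum_prod_type, ← Finset.sum_add_distrib, Finset.sum_div]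
  refine Finset.sum_congr rfl fun i _ => ?_
  rw [← Finset.sum_add_distrib, Finset.sum_div]
  refine Finset.sum_congr rfl fun j _ => ?_
  simp [tensorSq, symGrad]
  ring

/-- The scalar `v · U` has derivative `v ⊗ v : e(U)` along `v`. The fourth power of `‖v‖` is `‖v ⊗
v‖²`. -/
lemma lintegral_inner_translate_sub_le {Ω A : Set (E n)} {U : E n → E n}
    {G : Fin n → E n → E n} (h : ∀ i, HasWeakGrad Ω (fun x => U x i) (G i)) (hA : IsOpen A)
    (hU : Integrable U) (hU2 : MemLp U 2) (hG2 : ∀ i, MemLp (G i) 2) (v : E n)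
    (hAΩ : ∀ x ∈ A, ∀ t ∈ Set.Icc (0 : ℝ) 1, x + t • v ∈ Ω) :
    ∫⁻ x in A, ‖(inner ℝ v (U (x + v)) - inner ℝ v (U x) : ℝ)‖ₑ ^ 2 ≤
      ‖v‖ₑ ^ 4 * ∫⁻ x, ‖symGrad G x‖ₑ ^ 2 := by
  have hG2' : ∀ i j, MemLp (fun x => v i * v j * G i x j) 2 := fun i j =>
    (memLp_coord (hG2 i) j).const_mul _
  have hk2 : MemLp (fun x => ∑ i, ∑ j, v i * v j * G i x j) 2 :=
    memLp_finsetSum _ fun i _ => memLp_finsetSum _ fun j _ => hG2' i j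
  have hUi : ∀ i, MemLp (fun x => U x i) 2 := memLp_coord hU2
  refine (PoincareKorn.lintegral_translate_sub_le hA (hU.const_inner v) (hU2.const_inner v) hk2 v
    (fun φ hφ => ?_) hAΩ).trans ?_
  · have e1 : ∀ x, inner ℝ v (U x) * fderiv ℝ φ x v =
        ∑ i, ∑ j, v i * v j * (U x i * partialDeriv j φ x) := fun x => by
      rw [fderiv_eq_sum_partialDeriv, PiLp.inner_apply, Finset.sum_mul_sum]
      refine Finset.sum_congr rfl fun i _ => Finset.sum_congr rfl fun j _ => ?_
      simp
      ring
    have e2 : ∀ x, (∑ i, ∑ j, v i * v j * G i x j) * φ x =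
        ∑ i, ∑ j, v i * v j * (G i x j * φ x) := fun x => by
      simp only [Finset.sum_mul, mul_assoc]
    have i1 : ∀ i j, Integrable fun x => v i * v j * (U x i * partialDeriv j φ x) := fun i j =>
      ((hUi i).integrable_mul (hφ.memLp_partialDeriv j (p := 2) volume)).const_mul _
    have i2 : ∀ i j, Integrable fun x => v i * v j * (G i x j * φ x) := fun i j =>
      ((memLp_coord (hG2 i) j).integrable_mul (hφ.memLp (p := 2) volume)).const_mul _
    simp only [e1, e2]
    rw [integral_finsetSum _ fun i _ => integrable_finsetSum _ fun j _ => i1 i j,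
      integral_finsetSum _ fun i _ => integrable_finsetSum _ fun j _ => i2 i j,
      ← Finset.sum_neg_distrib]
    refine Finset.sum_congr rfl fun i _ => ?_
    rw [integral_finsetSum _ fun j _ => i1 i j, integral_finsetSum _ fun j _ => i2 i j,
      ← Finset.sum_neg_distrib]
    refine Finset.sum_congr rfl fun j _ => ?_
    rw [integral_const_mul, integral_const_mul, h i φ hφ j, mul_neg]
  · rw [← lintegral_const_mul' _ _ (by simp)]
    refine lintegral_mono fun x => ?_
    rw [show 4 = 2 * 2 from rfl, pow_mul, ← mul_pow]
    gcongr
    rw [← inner_tensorSq_symGrad]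
    simp only [← ofReal_norm]
    rw [← ENNReal.ofReal_pow (norm_nonneg _), ← norm_tensorSq,
      ← ENNReal.ofReal_mul (norm_nonneg _)]
    exact ENNReal.ofReal_le_ofReal (norm_inner_le_norm _ _)

end WeakGradient

/-! ### Zero trace: extension by zero across the base. -/

section Trace

variable {d : ℕ} {f : E d → ℝ}

/-- A smooth cutoff in the vertical variable. -/
noncomputable def heightCutoff (k : ℕ) (x : E (d + 1)) : ℝ :=
  Real.smoothTransition (((k : ℝ) + 1) * x (Fin.last d) - 1)

lemma contDiff_heightCutoff (k : ℕ) : ContDiff ℝ ∞ (heightCutoff (d := d) k) := by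
  unfold heightCutoff
  exact Real.smoothTransition.contDiff.comp (by fun_prop)

lemma tsupport_heightCutoff_subset (k : ℕ) :
    tsupport (heightCutoff (d := d) k) ⊆ {x | 0 < x (Fin.last d)} := by
  have hc : Continuous fun x : E (d + 1) => x (Fin.last d) := by fun_prop
  have h : tsupport (heightCutoff (d := d) k) ⊆ {x | 1 / ((k : ℝ) + 1) ≤ x (Fin.last d)} := by
    refine closure_minimal (fun x hx => ?_) (isClosed_le continuous_const hc)
    by_contra hlt
    refine Function.mem_support.1 hx (Real.smoothTransition.zero_of_nonpos ?_)
    rw [Set.mem_ofPred_eq, not_le, lt_div_iff₀ (by positivity)] at hlt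
    linarith
  exact h.trans fun x hx => lt_of_lt_of_le (b := 1 / ((k : ℝ) + 1)) (by positivity) hx

lemma abs_heightCutoff_le (k : ℕ) (x : E (d + 1)) : |heightCutoff k x| ≤ 1 := by
  rw [heightCutoff, abs_of_nonneg (Real.smoothTransition.nonneg _)]
  exact Real.smoothTransition.le_one _

lemma partialDeriv_castSucc_heightCutoff (k : ℕ) (x : E (d + 1)) (i : Fin d) :
    partialDeriv i.castSucc (heightCutoff k) x = 0 := by
  set s : ℝ → ℝ := fun r => Real.smoothTransition (((k : ℝ) + 1) * r - 1)
  have hs : ContDiff ℝ 1 s := Real.smoothTransition.contDiff.comp (by fun_prop)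
  have h := ((hs.differentiable (by simp)) (x (Fin.last d))).hasFDerivAt.comp (f := fun x : E (d + 1) => x (Fin.last d)) x
    (EuclideanSpace.proj (Fin.last d) : E (d + 1) →L[ℝ] ℝ).hasFDerivAt
  have h' : HasFDerivAt (heightCutoff k) _ x := h
  simp [partialDeriv, h'.fderiv, (Fin.castSucc_lt_last i).ne']

lemma tendsto_integral_mul_heightCutoff {μ : Measure (E (d + 1))} {h : E (d + 1) → ℝ}
    (hh : Integrable h μ) (hμ : ∀ᵐ x ∂μ, 0 < x (Fin.last d)) :
    Filter.Tendsto (fun k => ∫ x, h x * heightCutoff k x ∂μ) Filter.atTop (nhds (∫ x, h x ∂μ)) := by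
  refine tendsto_integral_of_dominated_convergence (fun x => ‖h x‖) (fun k => ?_) hh.norm
    (fun k => ?_) ?_
  · exact hh.1.mul (contDiff_heightCutoff k).continuous.aestronglyMeasurable
  · refine Filter.Eventually.of_forall fun x => ?_
    rw [norm_mul]
    exact mul_le_of_le_one_right (norm_nonneg _) (abs_heightCutoff_le k x)
  · filter_upwards [hμ] with x hx
    refine tendsto_const_nhds.congr' ?_
    -- The cutoff equals `1` as soon as `x_N ≥ 2 / (k + 1)`.
    obtain ⟨K, hK⟩ := exists_nat_gt (2 / x (Fin.last d))
    filter_upwards [Filter.eventually_ge_atTop K] with k hk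
    have hk' : (K : ℝ) ≤ k := by exact_mod_cast hk
    rw [div_lt_iff₀ hx] at hK
    rw [heightCutoff, Real.smoothTransition.one_of_one_le (by nlinarith), mul_one]

/-- The cutoff removes the support near the base, so the definition of the weak gradient, which only
tests inside `Q_f`, becomes applicable. -/
lemma IsTestFunction.heightCutoff_mul (hf : ContinuousOn f (openCube d)) {φ : E (d + 1) → ℝ}
    (h : IsTestFunction (belowGraph f) φ) (k : ℕ) :
    IsTestFunction (interior (Q f)) (heightCutoff k * φ) := by
  refine ⟨(contDiff_heightCutoff k).mul h.1, h.2.1.mul_left, fun x hx => ?_⟩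
  refine openQ_subset_interior hf ⟨h.2.2 ?_, tsupport_heightCutoff_subset k ?_⟩
  · exact tsupport_mul_subset_right hx
  · exact tsupport_mul_subset_left hx

/-- If the trace on the base vanishes, then the extension by zero across the base is weakly
differentiable. -/
lemma HasBaseTrace.integral_mul_partialDeriv (hf : ContinuousOn f (openCube d))
    {u : E (d + 1) → ℝ} {g : E (d + 1) → E (d + 1)} (hu : IsH1 (Q f) u g)
    (h0 : HasBaseTrace f u g 0) {φ : E (d + 1) → ℝ} (hφ : IsTestFunction (belowGraph f) φ)
    (i : Fin (d + 1)) :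
    ∫ x in Q f, u x * partialDeriv i φ x = -∫ x in Q f, g x i * φ x := by
  obtain ⟨hu2, hg2, hw⟩ := hu
  refine Fin.lastCases ?_ (fun j => ?_) i
  -- The vertical derivative is Green's formula with zero trace. For a horizontal one, the cutoff
  -- depends on the height only and contributes no derivative, so the identity for the cut-off test
  -- function passes to the limit.
  · simpa using h0.2 φ hφ
  · have hpos : ∀ᵐ x ∂volume.restrict (Q f), 0 < x (Fin.last d) := by
      rw [← Measure.restrict_congr_set (openQ_ae_eq hf)]
      filter_upwards [ae_restrict_mem (isOpen_openQ hf).measurableSet] with x hx using hx.2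
    have h1 := tendsto_integral_mul_heightCutoff
      (hu2.integrable_mul (hφ.memLp_partialDeriv j.castSucc (p := 2) _)) hpos
    have h2 := (tendsto_integral_mul_heightCutoff
      ((memLp_coord hg2 j.castSucc).integrable_mul (hφ.memLp (p := 2) _)) hpos).neg
    refine tendsto_nhds_unique h1 (h2.congr fun k => ?_)
    have h3 := hw _ (hφ.heightCutoff_mul hf k) j.castSucc
    have h4 : ∀ x, partialDeriv j.castSucc (heightCutoff k * φ) x =
        partialDeriv j.castSucc φ x * heightCutoff k x := fun x => by
      have h5 := partialDeriv_castSucc_heightCutoff k x j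
      unfold partialDeriv at h5 ⊢
      rw [fderiv_mul ((contDiff_heightCutoff k).differentiable (by simp) x)
        (hφ.1.differentiable (by simp) x)]
      simp [h5, mul_comm]
    simp only [h4, Pi.mul_apply] at h3
    simp only [Pi.mul_apply, mul_assoc]
    rw [h3]
    simp only [mul_comm]

end Trace

/-! ### Elementary inequalities for squares and double integrals. -/

section SquareEstimates

lemma enorm_add_sq_le {F : Type*} [SeminormedAddCommGroup F] (a b : F) :
    ‖a + b‖ₑ ^ 2 ≤ 2 * ‖a‖ₑ ^ 2 + 2 * ‖b‖ₑ ^ 2 := by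
  have h : ‖a + b‖₊ ^ 2 ≤ 2 * ‖a‖₊ ^ 2 + 2 * ‖b‖₊ ^ 2 := by
    rw [← NNReal.coe_le_coe]
    push_cast
    nlinarith [norm_add_le a b, norm_nonneg (a + b), sq_nonneg (‖a‖ - ‖b‖)]
  simp only [enorm_eq_nnnorm]
  exact_mod_cast h

lemma enorm_sum_sq_le {ι F : Type*} [Fintype ι] [SeminormedAddCommGroup F] (a : ι → F) :
    ‖∑ i, a i‖ₑ ^ 2 ≤ Fintype.card ι * ∑ i, ‖a i‖ₑ ^ 2 := by
  have h : ‖∑ i, a i‖₊ ^ 2 ≤ Fintype.card ι * ∑ i, ‖a i‖₊ ^ 2 := by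
    refine le_trans ?_ (sq_sum_le_card_mul_sum_sq (s := Finset.univ) (f := fun i => ‖a i‖₊))
    gcongr
    exact nnnorm_sum_le _ _
  simp only [enorm_eq_nnnorm]
  exact_mod_cast h

lemma enorm_sq_eq_sum {n : ℕ} (x : E n) : ‖x‖ₑ ^ 2 = ∑ i, ‖x i‖ₑ ^ 2 := by
  have h : ‖x‖₊ ^ 2 = ∑ i, ‖x i‖₊ ^ 2 := by
    rw [EuclideanSpace.nnnorm_eq, NNReal.sq_sqrt]
  simp only [enorm_eq_nnnorm]
  exact_mod_cast h

lemma sq_lintegral_le {α F : Type*} [MeasurableSpace α] [NormedAddCommGroup F] {μ : Measure α}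
    {f : α → F} (hf : AEStronglyMeasurable f μ) :
    (∫⁻ x, ‖f x‖ₑ ∂μ) ^ 2 ≤ μ Set.univ * ∫⁻ x, ‖f x‖ₑ ^ 2 ∂μ := by
  have h := eLpNorm_le_eLpNorm_mul_rpow_measure_univ (p := 1) (q := 2) (by norm_num) hf
  rw [eLpNorm_one_eq_lintegral_enorm] at h
  refine (pow_le_pow_left' h 2).trans (le_of_eq ?_)
  rw [mul_pow, sq_eLpNorm_two, ← ENNReal.rpow_natCast, ← ENNReal.rpow_mul, mul_comm]
  norm_num

lemma enorm_integral_mul_sq_le {α : Type*} [MeasurableSpace α] {μ : Measure α} {C : Set α}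
    {ψ F : α → ℝ} {K : ℝ≥0}
    (hψK : ∀ x, ‖ψ x‖ ≤ K) (hψ0 : ∀ x ∉ C, ψ x = 0) (hF : AEStronglyMeasurable F μ) :
    ‖∫ x, ψ x * F x ∂μ‖ₑ ^ 2 ≤ (K ^ 2 * μ C) * ∫⁻ x in C, ‖F x‖ₑ ^ 2 ∂μ := by
  rw [← setIntegral_eq_integral_of_forall_compl_eq_zero (s := C)
    (fun x hx => by rw [hψ0 x hx, zero_mul])]
  have h1 : ‖∫ x in C, ψ x * F x ∂μ‖ₑ ≤ K * ∫⁻ x in C, ‖F x‖ₑ ∂μ := by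
    refine (enorm_integral_le_lintegral_enorm _).trans ?_
    rw [← lintegral_const_mul' _ _ (by simp)]
    refine lintegral_mono fun x => ?_
    rw [enorm_mul]
    gcongr
    rw [enorm_eq_nnnorm]
    exact ENNReal.coe_le_coe.2 (hψK x)
  refine (pow_le_pow_left' h1 2).trans ?_
  rw [mul_pow, mul_assoc]
  gcongr
  simpa using sq_lintegral_le hF.restrict

/-- Substitute `y = x + v` and exchange the integrals: `v` runs through a ball of radius `R`, and
each inner integral is a translation estimate. -/
lemma lintegral_lintegral_le_of_translates {n : ℕ} {C : Set (E n)} (hC : MeasurableSet C) {R : ℝ}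
    (hR : ∀ x ∈ C, ∀ y ∈ C, ‖y - x‖ ≤ R) {H : E n → E n → ℝ≥0∞}
    (Hm : Measurable (Function.uncurry H)) {T : ℝ≥0∞}
    (hT : ∀ v, ‖v‖ ≤ R → ∫⁻ x in {x | x ∈ C ∧ x + v ∈ C}, H v x ≤ T) :
    ∫⁻ x in C, ∫⁻ y in C, H (y - x) x ≤ volume (Metric.closedBall (0 : E n) R) * T := by
  set D : Set (E n × E n) := {p | p.2 ∈ C ∧ p.2 + p.1 ∈ C} with hD
  have hDm : MeasurableSet D :=
    (measurable_snd hC).inter ((measurable_snd.add measurable_fst) hC)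
  set K : E n × E n → ℝ≥0∞ := D.indicator (Function.uncurry H) with hK
  have hKm : Measurable K := Hm.indicator hDm
  calc ∫⁻ x in C, ∫⁻ y in C, H (y - x) x
      = ∫⁻ x, ∫⁻ v, K (v, x) := by
        rw [← lintegral_indicator hC]
        refine lintegral_congr fun x => ?_
        by_cases hx : x ∈ C
        · rw [Set.indicator_of_mem hx, ← lintegral_indicator hC,
            ← lintegral_add_right_eq_self _ x]
          refine lintegral_congr fun y => ?_
          by_cases hy : y + x ∈ C
          · rw [Set.indicator_of_mem hy, hK,
              Set.indicator_of_mem (show (y, x) ∈ D from ⟨hx, add_comm y x ▸ hy⟩)]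
            simp
          · rw [Set.indicator_of_notMem hy, hK,
              Set.indicator_of_notMem fun h : (y, x) ∈ D => hy (add_comm x y ▸ h.2)]
        · rw [Set.indicator_of_notMem hx]
          simp [hK, hD, hx]
    _ = ∫⁻ v, ∫⁻ x, K (v, x) := by
        rw [lintegral_lintegral_swap]
        exact (hKm.comp measurable_swap).aemeasurable
    _ ≤ ∫⁻ v, (Metric.closedBall (0 : E n) R).indicator (fun _ => T) v := by
        refine lintegral_mono fun v => ?_
        by_cases hv : ‖v‖ ≤ R
        · rw [Set.indicator_of_mem (by simpa using hv)]
          refine le_trans (le_of_eq ?_) (hT v hv)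
          have hm : MeasurableSet {x | x ∈ C ∧ x + v ∈ C} :=
            hC.inter ((measurable_id.add_const v) hC)
          rw [← lintegral_indicator hm]
          rfl
        · refine le_trans (le_of_eq ?_) zero_le
          have h0 : ∀ x, K (v, x) = 0 := fun x => Set.indicator_of_notMem
            (fun h => hv (by simpa using hR _ h.1 _ h.2)) _
          simp [h0]
    _ = volume (Metric.closedBall (0 : E n) R) * T := by
        rw [lintegral_indicator Metric.isClosed_closedBall.measurableSet]
        simp [mul_comm]

end SquareEstimates

/-! ### Translation estimates on the convex unit cube. -/

section UnitCube

variable {n : ℕ}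

lemma abs_coord_le_of_mem_openCube {x : E n} (hx : x ∈ openCube n) (i : Fin n) : |x i| ≤ 1 := by
  rw [abs_of_pos (hx i).1]
  exact (hx i).2.le

lemma convex_openCube : Convex ℝ (openCube n) := by
  have : openCube n = (⋂ i : Fin n, {y : E n | 0 < y i}) ∩ ⋂ i : Fin n, {y : E n | y i < 1} := by
    ext y
    simp [openCube, forall_and]
  rw [this]
  have h : ∀ i, IsLinearMap ℝ fun y : E n => y i := fun i => ⟨fun _ _ => rfl, fun _ _ => rfl⟩
  exact (convex_iInter fun i => convex_halfSpace_gt (h i) 0).inter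
    (convex_iInter fun i => convex_halfSpace_lt (h i) 1)

lemma norm_sub_le_of_mem_openCube {x y : E n} (hx : x ∈ openCube n) (hy : y ∈ openCube n) :
    ‖y - x‖ ≤ n := by
  have := norm_le_of_forall_abs_le (x := y - x) (M := 1) fun i => by
    rw [PiLp.sub_apply, abs_le]
    constructor <;> linarith [(hx i).1, (hx i).2, (hy i).1, (hy i).2]
  simpa using this

lemma volume_openCube_lt_top : volume (openCube n) < ⊤ := by
  refine (measure_mono fun x hx => ?_).trans_lt
    (measure_closedBall_lt_top (x := (0 : E n)) (r := n * 1))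
  rw [mem_closedBall_zero_iff]
  exact norm_le_of_forall_abs_le (abs_coord_le_of_mem_openCube hx)

/-- The double-integral form of a translation estimate on the cube. -/
lemma lintegral_cube_cube_le {W : E n → E n → ℝ} (hW : Measurable (Function.uncurry W))
    {T : ℝ≥0∞} (hT : ∀ v, ‖v‖ ≤ n → ∀ A, IsOpen A →
      (∀ x ∈ A, ∀ t ∈ Set.Icc (0 : ℝ) 1, x + t • v ∈ openCube n) →
      ∫⁻ x in A, ‖W v (x + v) - W v x‖ₑ ^ 2 ≤ T) :
    ∫⁻ x in openCube n, ∫⁻ y in openCube n, ‖W (y - x) y - W (y - x) x‖ₑ ^ 2 ≤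
      volume (Metric.closedBall (0 : E n) n) * T := by
  have h := lintegral_lintegral_le_of_translates (H := fun v x => ‖W v (x + v) - W v x‖ₑ ^ 2)
    isOpen_openCube.measurableSet (fun x hx y hy => norm_sub_le_of_mem_openCube hx hy) ?_
    (fun v hv => hT v hv _ ?_ ?_)
  · simpa using h
  · have h1 : Measurable fun p : E n × E n => W p.1 (p.2 + p.1) :=
      hW.comp (measurable_fst.prodMk (measurable_snd.add measurable_fst))
    exact ((h1.sub hW).enorm).pow_const 2
  · exact isOpen_openCube.inter (isOpen_openCube.preimage (continuous_id.add continuous_const))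
  · rintro x ⟨h1, h2⟩ t ht
    have := convex_openCube.add_smul_sub_mem h1 h2 ht
    simpa using this

end UnitCube

/-! ### Bounded weights biorthogonal to the coordinates. -/

section Weights

variable {n : ℕ}

/-- The cube `(0,1/2)ⁿ`. -/
def halfCube (n : ℕ) : Set (E n) := {y | ∀ i, 0 < y i ∧ y i < 1 / 2}

lemma halfCube_subset : halfCube n ⊆ openCube n :=
  fun _ hy i => ⟨(hy i).1, (hy i).2.trans (by norm_num)⟩

lemma isOpen_halfCube : IsOpen (halfCube n) := by
  have : halfCube n = ⋂ i : Fin n, {y : E n | 0 < y i ∧ y i < 1 / 2} := by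
    ext y; simp [halfCube]
  rw [this]
  refine isOpen_iInter_of_finite fun i => ?_
  have h : Continuous fun y : E n => y i := by fun_prop
  exact (isOpen_lt continuous_const h).inter (isOpen_lt h continuous_const)

lemma volume_halfCube_lt_top : volume (halfCube n) < ⊤ :=
  (measure_mono halfCube_subset).trans_lt volume_openCube_lt_top

lemma volume_real_halfCube_pos : 0 < volume.real (halfCube n) := by
  refine ENNReal.toReal_pos (isOpen_halfCube.measure_pos volume ?_).ne' volume_halfCube_lt_top.ne
  exact ⟨WithLp.toLp 2 fun _ => 1 / 4, fun i => by norm_num⟩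

/-- The difference of the indicators of the half cube translated by `eᵢ/2` and of the half cube,
normalized so that these functions are dual to the coordinates. -/
noncomputable def dualWeight (i : Fin n) (y : E n) : ℝ :=
  2 / volume.real (halfCube n) *
    ((halfCube n).indicator 1 (y - EuclideanSpace.single i (1 / 2)) - (halfCube n).indicator 1 y)

lemma measurable_dualWeight (i : Fin n) : Measurable (dualWeight i) := by
  have h : Measurable ((halfCube n).indicator (1 : E n → ℝ)) :=
    measurable_one.indicator isOpen_halfCube.measurableSet
  exact ((h.comp (measurable_id.sub_const _)).sub h).const_mul _

lemma norm_dualWeight_le (i : Fin n) (y : E n) :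
    ‖dualWeight i y‖ ≤ (2 / volume.real (halfCube n)).toNNReal := by
  have h : ∀ z : E n, 0 ≤ (halfCube n).indicator (1 : E n → ℝ) z ∧
      (halfCube n).indicator (1 : E n → ℝ) z ≤ 1 := fun z => by
    by_cases hz : z ∈ halfCube n <;> simp [hz]
  have hp := div_pos two_pos (volume_real_halfCube_pos (n := n))
  rw [Real.coe_toNNReal _ hp.le, dualWeight, norm_mul, Real.norm_of_nonneg hp.le]
  refine mul_le_of_le_one_right hp.le ?_
  rw [Real.norm_eq_abs, abs_le]
  constructor <;> linarith [h y, h (y - EuclideanSpace.single i (1 / 2))]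

lemma dualWeight_eq_zero (i : Fin n) {y : E n} (hy : y ∉ openCube n) : dualWeight i y = 0 := by
  have h1 : y ∉ halfCube n := fun h => hy (halfCube_subset h)
  have h2 : y - EuclideanSpace.single i (1 / 2) ∉ halfCube n := fun h => hy fun j => by
    have := h j
    by_cases hj : j = i
    · subst hj
      simp only [PiLp.sub_apply, PiLp.single_apply, if_true] at this
      constructor <;> linarith
    · simp only [PiLp.sub_apply, PiLp.single_apply, hj, if_false, sub_zero] at this
      constructor <;> linarith
  rw [dualWeight, Set.indicator_of_notMem h1, Set.indicator_of_notMem h2, sub_zero, mul_zero]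

lemma integrable_dualWeight_mul {h : E n → ℝ} (hh : Integrable h) (i : Fin n) :
    Integrable fun y => dualWeight i y * h y :=
  hh.bdd_mul (measurable_dualWeight i).aestronglyMeasurable
    (Filter.Eventually.of_forall (norm_dualWeight_le i))

lemma integrable_indicator_halfCube_mul {h : E n → ℝ} (hh : Continuous h) :
    Integrable fun y => (halfCube n).indicator 1 y * h y := by
  have h1 : (fun y => (halfCube n).indicator 1 y * h y) = (halfCube n).indicator h := by
    ext y
    by_cases hy : y ∈ halfCube n <;> simp [hy]
  rw [h1, integrable_indicator_iff isOpen_halfCube.measurableSet]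
  refine (hh.continuousOn.integrableOn_compact
    (isCompact_closedBall (0 : E n) (n * 1))).mono_set fun x hx => ?_
  rw [mem_closedBall_zero_iff]
  exact norm_le_of_forall_abs_le (abs_coord_le_of_mem_openCube (halfCube_subset hx))

lemma integrable_dualWeight_mul_continuous {h : E n → ℝ} (hh : Continuous h) (i : Fin n) :
    Integrable fun y => dualWeight i y * h y := by
  have h1 := ((integrable_indicator_halfCube_mul (h := fun y =>
    h (y + EuclideanSpace.single i (1 / 2))) (by fun_prop)).comp_sub_right
      (EuclideanSpace.single i (1 / 2))).sub (integrable_indicator_halfCube_mul hh)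
  refine (h1.const_mul (2 / volume.real (halfCube n))).congr
    (Filter.Eventually.of_forall fun y => ?_)
  simp [dualWeight]
  ring

/-- Moving the shift from the weight to `h` leaves the constant difference `c / 2` averaged over the
half cube; the factor `2` in the weight compensates for the step `1 / 2`. -/
lemma integral_dualWeight_mul {h : E n → ℝ} (hh : Continuous h) (i : Fin n) {c : ℝ}
    (hc : ∀ y, h (y + EuclideanSpace.single i (1 / 2)) - h y = c / 2) :
    ∫ y, dualWeight i y * h y = c := by
  have h2 := (integrable_indicator_halfCube_mul (h := fun y =>
    h (y + EuclideanSpace.single i (1 / 2))) (by fun_prop))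
  have h1 := h2.comp_sub_right (EuclideanSpace.single i (1 / 2))
  have h3 : ∀ y, dualWeight i y * h y = 2 / volume.real (halfCube n) *
      ((halfCube n).indicator 1 (y - EuclideanSpace.single i (1 / 2)) *
        h (y - EuclideanSpace.single i (1 / 2) + EuclideanSpace.single i (1 / 2)) -
        (halfCube n).indicator 1 y * h y) := fun y => by
    simp [dualWeight]
    ring
  simp only [h3]
  rw [integral_const_mul, integral_sub h1 (integrable_indicator_halfCube_mul hh),
    integral_sub_right_eq_self (fun y => (halfCube n).indicator 1 y *
      h (y + EuclideanSpace.single i (1 / 2))), ← integral_sub h2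
      (integrable_indicator_halfCube_mul hh)]
  simp only [← mul_sub, hc]
  rw [integral_mul_const, integral_indicator_one isOpen_halfCube.measurableSet]
  have := (volume_real_halfCube_pos (n := n)).ne'
  field_simp

lemma integrable_dualWeight (i : Fin n) : Integrable (dualWeight i) := by
  simpa using integrable_dualWeight_mul_continuous (continuous_const (y := (1 : ℝ))) i

lemma integral_dualWeight (i : Fin n) : ∫ y, dualWeight i y = 0 := by
  simpa using integral_dualWeight_mul (continuous_const (y := (1 : ℝ))) i (c := 0) (by simp)

lemma integral_dualWeight_mul_coord (i j : Fin n) :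
    ∫ y, dualWeight i y * y j = if j = i then 1 else 0 :=
  integral_dualWeight_mul (h := fun y => y j) (by fun_prop) i fun y => by
    by_cases h : j = i <;> simp [h]

end Weights

/-! ### Approximation by rigid motions and by constants on the unit cube. -/

section CubeApproximation

variable {n : ℕ}

/-- The affine map `x ↦ a + S x`, which is a rigid motion if `S` is skew-symmetric. -/
noncomputable def rigidMap (a : E n) (S : Fin n → Fin n → ℝ) (x : E n) : E n :=
  a + WithLp.toLp 2 fun i => ∑ j, S i j * x j

@[simp] lemma rigidMap_apply (a : E n) (S : Fin n → Fin n → ℝ) (x : E n) (i : Fin n) :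
    rigidMap a S x i = a i + ∑ j, S i j * x j := rfl

lemma continuous_rigidMap (a : E n) (S : Fin n → Fin n → ℝ) : Continuous (rigidMap a S) := by
  unfold rigidMap
  fun_prop

lemma sum_sum_mul_eq_zero_of_skew {S : Fin n → Fin n → ℝ} (hS : ∀ i j, S i j = -S j i)
    (v : E n) : ∑ i, ∑ j, S i j * v j * v i = 0 := by
  have h : ∑ i, ∑ j, S i j * v j * v i = -∑ i, ∑ j, S i j * v j * v i := by
    conv_rhs => rw [Finset.sum_comm]
    simp only [← Finset.sum_neg_distrib]
    refine Finset.sum_congr rfl fun i _ => Finset.sum_congr rfl fun j _ => ?_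
    rw [hS i j]
    ring
  linarith

/-- The increment is `v · S v`, which vanishes for skew `S`: rigid motions have no longitudinal
differences. -/
lemma inner_rigidMap_add {a : E n} {S : Fin n → Fin n → ℝ} (hS : ∀ i j, S i j = -S j i)
    (x v : E n) : inner ℝ v (rigidMap a S (x + v)) = inner ℝ v (rigidMap a S x) := by
  have h : rigidMap a S (x + v) = rigidMap a S x + rigidMap 0 S v := by
    ext i
    simp [mul_add, Finset.sum_add_distrib, add_assoc]
  rw [h, inner_add_right, add_eq_left, PiLp.inner_apply]
  refine Eq.trans ?_ (sum_sum_mul_eq_zero_of_skew hS v)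
  simp [Finset.sum_mul]

/-- The quantity `(U y - U x) · (y - x)`, averaged in `y` against a dual weight. -/
noncomputable def strainAverage (U : E n → E n) (i : Fin n) (x : E n) : ℝ :=
  ∫ y, dualWeight i y * (inner ℝ (y - x) (U y) - inner ℝ (y - x) (U x))

lemma integrable_dualWeight_mul_coord_mul {h : E n → ℝ} (hh : Integrable h) (i k : Fin n) :
    Integrable fun y => dualWeight i y * y k * h y := by
  refine hh.bdd_mul (c := (2 / volume.real (halfCube n)).toNNReal)
    ((measurable_dualWeight i).aestronglyMeasurable.mul
      (Continuous.aestronglyMeasurable (by fun_prop))) (Filter.Eventually.of_forall fun y => ?_)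
  by_cases hy : y ∈ openCube n
  · rw [norm_mul]
    exact (mul_le_of_le_one_right (norm_nonneg _) (abs_coord_le_of_mem_openCube hy k)).trans
      (norm_dualWeight_le i y)
  · simp [dualWeight_eq_zero i hy]

lemma integrable_coord {U : E n → E n} (hU : Integrable U) (i : Fin n) :
    Integrable fun x => U x i :=
  (EuclideanSpace.proj i : E n →L[ℝ] ℝ).integrable_comp hU

/-- After expansion, `∫ dualWeight i = 0` removes the term `x · U x`, and duality with the
coordinates extracts `U x i` from `y · U x`. Thus `U` is an affine map minus a small error. -/
lemma strainAverage_eq {U : E n → E n} (hU : Integrable U) (i : Fin n) (x : E n) :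
    strainAverage U i x = (∑ k, ∫ y, dualWeight i y * y k * U y k) -
      (∑ k, (∫ y, dualWeight i y * U y k) * x k) - U x i := by
  have i1 : ∀ k, Integrable fun y => dualWeight i y * y k * U y k := fun k =>
    integrable_dualWeight_mul_coord_mul (integrable_coord hU k) i k
  have i2 : ∀ k, Integrable fun y => dualWeight i y * U y k * x k := fun k =>
    (integrable_dualWeight_mul (integrable_coord hU k) i).mul_const _
  have i3 : ∀ k, Integrable fun y : E n => dualWeight i y * y k * U x k := fun k =>
    (integrable_dualWeight_mul_continuous (by fun_prop) i).mul_const _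
  have i4 : ∀ k, Integrable fun y => dualWeight i y * (x k * U x k) := fun k =>
    (integrable_dualWeight i).mul_const _
  have j1 : ∀ k, Integrable fun y => dualWeight i y * y k * U y k -
      dualWeight i y * U y k * x k := fun k => (i1 k).sub (i2 k)
  have j2 : ∀ k, Integrable fun y => dualWeight i y * y k * U y k -
      dualWeight i y * U y k * x k - dualWeight i y * y k * U x k := fun k => (j1 k).sub (i3 k)
  have j3 : ∀ k, Integrable fun y => dualWeight i y * y k * U y k -
      dualWeight i y * U y k * x k - dualWeight i y * y k * U x k +
      dualWeight i y * (x k * U x k) := fun k => (j2 k).add (i4 k)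
  have h1 : ∀ y, dualWeight i y * (inner ℝ (y - x) (U y) - inner ℝ (y - x) (U x)) =
      ∑ k, (dualWeight i y * y k * U y k - dualWeight i y * U y k * x k
        - dualWeight i y * y k * U x k + dualWeight i y * (x k * U x k)) := fun y => by
    rw [PiLp.inner_apply, PiLp.inner_apply, ← Finset.sum_sub_distrib, Finset.mul_sum]
    refine Finset.sum_congr rfl fun k _ => ?_
    simp
    ring
  have h2 : ∀ k, ∫ y, (dualWeight i y * y k * U y k - dualWeight i y * U y k * x k
        - dualWeight i y * y k * U x k + dualWeight i y * (x k * U x k)) =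
      (∫ y, dualWeight i y * y k * U y k) - (∫ y, dualWeight i y * U y k) * x k -
        if k = i then U x k else 0 := fun k => by
    rw [integral_add (j2 k) (i4 k), integral_sub (j1 k) (i3 k), integral_sub (i1 k) (i2 k),
      integral_mul_const, integral_mul_const, integral_mul_const, integral_dualWeight, integral_dualWeight_mul_coord]
    simp
  simp only [strainAverage, h1]
  rw [integral_finsetSum _ fun k _ => j3 k]
  simp only [h2, Finset.sum_sub_distrib, Finset.sum_ite_eq', Finset.mem_univ, if_true]

/-- A second average isolates the symmetric part of the affine map from `strainAverage_eq`, and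
shows that it is as small as the error. -/
lemma integral_dualWeight_mul_strainAverage {U : E n → E n} (hU : Integrable U) (i j : Fin n) :
    ∫ x, dualWeight j x * strainAverage U i x =
      -(∫ y, dualWeight i y * U y j) - ∫ y, dualWeight j y * U y i := by
  set α := ∑ k, ∫ y, dualWeight i y * y k * U y k
  set m : Fin n → ℝ := fun k => ∫ y, dualWeight i y * U y k
  have i1 : Integrable fun x => dualWeight j x * α := (integrable_dualWeight j).mul_const _
  have i2 : ∀ k, Integrable fun x : E n => m k * (dualWeight j x * x k) := fun k =>
    (integrable_dualWeight_mul_continuous (by fun_prop) j).const_mul _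
  have i3 := integrable_dualWeight_mul (integrable_coord hU i) j
  have h1 : ∀ x, dualWeight j x * strainAverage U i x =
      dualWeight j x * α - (∑ k, m k * (dualWeight j x * x k)) - dualWeight j x * U x i :=
    fun x => by
      have h := strainAverage_eq hU i x
      change _ = α - ∑ k, m k * x k - _ at h
      simp only [mul_left_comm (m _), ← Finset.mul_sum, h]
      ring
  simp only [h1]
  have i4 : Integrable fun x : E n => ∑ k, m k * (dualWeight j x * x k) :=
    integrable_finsetSum _ fun k _ => i2 k
  have i5 : Integrable fun x : E n => dualWeight j x * α - ∑ k, m k * (dualWeight j x * x k) :=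
    i1.sub i4
  rw [integral_sub i5 i3, integral_sub i1 i4, integral_mul_const,
    integral_finsetSum _ fun k _ => i2 k, integral_dualWeight]
  simp [integral_const_mul, integral_dualWeight_mul_coord, m]

/-- On the unit cube, a field is close to a rigid motion if its longitudinal differences are
small. -/
lemma exists_rigidMap_approx (n : ℕ) : ∃ c : ℝ≥0, ∀ U : E n → E n, StronglyMeasurable U →
    Integrable U → ∀ T : ℝ≥0∞,
    (∀ v, ‖v‖ ≤ n → ∀ A, IsOpen A →
      (∀ x ∈ A, ∀ t ∈ Set.Icc (0 : ℝ) 1, x + t • v ∈ openCube n) →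
      ∫⁻ x in A, ‖(inner ℝ v (U (x + v)) - inner ℝ v (U x) : ℝ)‖ₑ ^ 2 ≤ T) →
    ∃ (a : E n) (S : Fin n → Fin n → ℝ), (∀ i j, S i j = -S j i) ∧
      ∫⁻ x in openCube n, ‖U x - rigidMap a S x‖ₑ ^ 2 ≤ c * T := by
  set K : ℝ≥0 := (2 / volume.real (halfCube n)).toNNReal
  set V : ℝ≥0∞ := volume (openCube n) with hV
  set κ : ℝ≥0∞ := K ^ 2 * V with hκ
  set B : ℝ≥0∞ := volume (Metric.closedBall (0 : E n) n) with hB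
  have hVt : V ≠ ⊤ := volume_openCube_lt_top.ne
  have hκt : κ ≠ ⊤ := ENNReal.mul_ne_top (by simp) hVt
  have hBt : B ≠ ⊤ := measure_closedBall_lt_top.ne
  have hct : n * (2 * κ + 2 * (n * (n * (κ * κ))) * V) * B ≠ ⊤ := by
    finiteness
  refine ⟨(n * (2 * κ + 2 * (n * (n * (κ * κ))) * V) * B).toNNReal, fun U hU hUi T hT => ?_⟩
  rw [ENNReal.coe_toNNReal hct]
  have hdbl := lintegral_cube_cube_le (W := fun v x => inner ℝ v (U x))
    (measurable_fst.inner (hU.measurable.comp measurable_snd)) hT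
  set D : Fin n → Fin n → ℝ := fun i j => ∫ x, dualWeight j x * strainAverage U i x
  set m : Fin n → Fin n → ℝ := fun i k => ∫ y, dualWeight i y * U y k
  have hmeas : ∀ i, Measurable (strainAverage U i) := fun i => by
    have hUm := hU.measurable
    rw [funext (strainAverage_eq hUi i)]
    fun_prop
  -- Cauchy–Schwarz in `y` against the bounded weight, then the double-integral bound.
  have herr : ∀ i, ∫⁻ x in openCube n, ‖strainAverage U i x‖ₑ ^ 2 ≤ κ * (B * T) := fun i => by
    refine le_trans (lintegral_mono fun x => ?_) ((lintegral_const_mul' κ _ hκt).le.trans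
      (mul_le_mul_right hdbl _))
    refine enorm_integral_mul_sq_le (norm_dualWeight_le i)
      (fun y hy => dualWeight_eq_zero i hy) (Measurable.aestronglyMeasurable ?_)
    exact ((measurable_id.sub_const x).inner hU.measurable).sub
      ((measurable_id.sub_const x).inner measurable_const)
  have hD : ∀ i j, ‖D i j‖ₑ ^ 2 ≤ κ * (κ * (B * T)) := fun i j =>
    (enorm_integral_mul_sq_le (norm_dualWeight_le j) (fun y hy => dualWeight_eq_zero j hy)
      (hmeas i).aestronglyMeasurable).trans (mul_le_mul_right (herr i) _)
  -- The affine map of `strainAverage_eq` has matrix `-m`; `S` is its skew part, and `D / 2` is its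
  -- symmetric part, left in the error.
  refine ⟨WithLp.toLp 2 fun i => ∑ k, ∫ y, dualWeight i y * y k * U y k,
    fun i j => (m j i - m i j) / 2, fun i j => by ring, ?_⟩
  have hcomp : ∀ x i, (U x - rigidMap (WithLp.toLp 2 fun i => ∑ k, ∫ y, dualWeight i y * y k * U y k)
      (fun i j => (m j i - m i j) / 2) x) i =
      -strainAverage U i x + ∑ j, D i j * (x j / 2) := fun x i => by
    have hDe : ∀ j, D i j = -m i j - m j i := integral_dualWeight_mul_strainAverage hUi i
    have he := strainAverage_eq hUi i x
    change _ = _ - ∑ k, m i k * x k - _ at he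
    simp only [hDe, he, PiLp.sub_apply, rigidMap_apply]
    rw [← sub_eq_zero]
    have : ∑ j, (m j i - m i j) / 2 * x j + (∑ j, (-m i j - m j i) * (x j / 2)) +
        ∑ k, m i k * x k = 0 := by
      rw [← Finset.sum_add_distrib, ← Finset.sum_add_distrib]
      exact Finset.sum_eq_zero fun j _ => by ring
    linarith
  have hpt : ∀ x ∈ openCube n, ‖U x - rigidMap
      (WithLp.toLp 2 fun i => ∑ k, ∫ y, dualWeight i y * y k * U y k)
      (fun i j => (m j i - m i j) / 2) x‖ₑ ^ 2 ≤
      ∑ i, (2 * ‖strainAverage U i x‖ₑ ^ 2 + 2 * (n * (n * (κ * (κ * (B * T)))))) := by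
    intro x hx
    rw [enorm_sq_eq_sum]
    refine Finset.sum_le_sum fun i _ => ?_
    rw [hcomp]
    refine (enorm_add_sq_le _ _).trans ?_
    rw [enorm_neg]
    gcongr
    refine (enorm_sum_sq_le _).trans ?_
    rw [Fintype.card_fin]
    gcongr
    refine (Finset.sum_le_card_nsmul _ _ (κ * (κ * (B * T))) fun j _ => ?_).trans (by simp)
    refine le_trans ?_ (hD i j)
    gcongr
    rw [← ofReal_norm, ← ofReal_norm, norm_mul]
    refine ENNReal.ofReal_le_ofReal (mul_le_of_le_one_right (norm_nonneg _) ?_)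
    rw [Real.norm_eq_abs, abs_div, abs_two]
    linarith [abs_coord_le_of_mem_openCube hx j]
  refine (setLIntegral_mono' isOpen_openCube.measurableSet hpt).trans ?_
  rw [lintegral_finsetSum _ fun i _ => by fun_prop]
  refine (Finset.sum_le_card_nsmul _ _
    (2 * (κ * (B * T)) + 2 * (n * (n * (κ * (κ * (B * T))))) * V) fun i _ => ?_).trans
    (le_of_eq ?_)
  · rw [lintegral_add_right _ measurable_const, lintegral_const_mul _ (by fun_prop)]
    gcongr
    · exact herr i
    · simp [hV]
  · simp only [Finset.card_univ, Fintype.card_fin, nsmul_eq_mul]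
    ring

/-- The scalar counterpart of `exists_rigidMap_approx`. -/
lemma exists_const_approx (n : ℕ) : ∃ c : ℝ≥0, ∀ w : E n → ℝ, StronglyMeasurable w →
    Integrable w → ∀ T : ℝ≥0∞,
    (∀ v, ‖v‖ ≤ n → ∀ A, IsOpen A →
      (∀ x ∈ A, ∀ t ∈ Set.Icc (0 : ℝ) 1, x + t • v ∈ openCube n) →
      ∫⁻ x in A, ‖w (x + v) - w x‖ₑ ^ 2 ≤ T) →
    ∃ m : ℝ, ∫⁻ x in openCube n, ‖w x - m‖ₑ ^ 2 ≤ c * T := by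
  set V : ℝ≥0∞ := volume (openCube n) with hV
  have hVt : V ≠ ⊤ := volume_openCube_lt_top.ne
  have hVp : 0 < V.toReal := ENNReal.toReal_pos (isOpen_openCube.measure_pos volume
    ⟨WithLp.toLp 2 fun _ => 1 / 2, fun i => by norm_num⟩).ne' hVt
  set K : ℝ≥0 := V.toReal⁻¹.toNNReal
  set κ : ℝ≥0∞ := K ^ 2 * V with hκ
  set B : ℝ≥0∞ := volume (Metric.closedBall (0 : E n) n) with hB
  have hκt : κ ≠ ⊤ := ENNReal.mul_ne_top (by simp) hVt
  have hBt : B ≠ ⊤ := measure_closedBall_lt_top.ne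
  refine ⟨(κ * B).toNNReal, fun w hw hwi T hT => ?_⟩
  rw [ENNReal.coe_toNNReal (by finiteness)]
  have hdbl := lintegral_cube_cube_le (W := fun _ x => w x) (hw.measurable.comp measurable_snd) hT
  set ψ : E n → ℝ := (openCube n).indicator fun _ => V.toReal⁻¹ with hψ
  have hψ0 : ∀ y ∉ openCube n, ψ y = 0 := fun y hy => Set.indicator_of_notMem hy _
  have hψm : Measurable ψ := measurable_const.indicator isOpen_openCube.measurableSet
  have hψK : ∀ y, ‖ψ y‖ ≤ K := fun y => by
    rw [Real.coe_toNNReal _ (by positivity)]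
    refine (norm_indicator_le_norm_self _ y).trans ?_
    rw [Real.norm_of_nonneg (by positivity)]
  have hψi : Integrable ψ := by
    rw [hψ, integrable_indicator_iff isOpen_openCube.measurableSet]
    exact integrableOn_const hVt
  have hψ1 : ∫ y, ψ y = 1 := by
    rw [hψ, integral_indicator_const _ isOpen_openCube.measurableSet, smul_eq_mul]
    exact mul_inv_cancel₀ hVp.ne'
  have hψw : Integrable fun y => ψ y * w y :=
    hwi.bdd_mul hψm.aestronglyMeasurable (Filter.Eventually.of_forall hψK)
  -- The constant is the mean of `w` over the cube.
  refine ⟨∫ y, ψ y * w y, ?_⟩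
  rw [mul_assoc]
  refine le_trans (lintegral_mono fun x => ?_) ((lintegral_const_mul' κ _ hκt).le.trans
    (mul_le_mul_right hdbl _))
  have h1 : w x - ∫ y, ψ y * w y = -∫ y, ψ y * (w y - w x) := by
    simp only [mul_sub]
    rw [integral_sub hψw (hψi.mul_const _), integral_mul_const, hψ1]
    ring
  simp only [h1, enorm_neg]
  exact enorm_integral_mul_sq_le hψK hψ0 (hw.measurable.sub_const _).aestronglyMeasurable

end CubeApproximation

/-! ### Descending translations: transporting bounds through `Q_f`. -/

section Spreading

variable {d : ℕ}

/-- The vector of horizontal part `z` and vertical component `-h`. -/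
noncomputable def downVec (z : E d) (h : ℝ) : E (d + 1) :=
  WithLp.toLp 2 (Fin.snoc (α := fun _ => ℝ) (fun i : Fin d => z i) (-h))

@[simp] lemma downVec_castSucc (z : E d) (h : ℝ) (i : Fin d) : downVec z h i.castSucc = z i := by
  simp [downVec]

@[simp] lemma downVec_last (z : E d) (h : ℝ) : downVec z h (Fin.last d) = -h := by
  simp [downVec]

@[simp] lemma horiz_downVec (z : E d) (h : ℝ) : horiz (downVec z h) = z := by
  ext i; simp

lemma norm_downVec_le {z : E d} {h : ℝ} (hh : 0 ≤ h) : ‖downVec z h‖ ≤ ‖z‖ + h := by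
  have h1 : ‖downVec z h‖ ^ 2 = ‖z‖ ^ 2 + h ^ 2 := by
    rw [EuclideanSpace.real_norm_sq_eq, EuclideanSpace.real_norm_sq_eq, Fin.sum_univ_castSucc]
    simp
  nlinarith [norm_nonneg z, norm_nonneg (downVec z h), mul_nonneg (norm_nonneg z) hh]

lemma inner_downVec (z : E d) (h : ℝ) (y : E (d + 1)) :
    inner ℝ (downVec z h) y = (∑ i, z i * y i.castSucc) - h * y (Fin.last d) := by
  rw [PiLp.inner_apply, Fin.sum_univ_castSucc]
  simp [mul_comm, sub_eq_add_neg]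

/-- Along the segment the graph falls by at most `L t ‖z‖`, while the point descends by `t h`. -/
lemma add_smul_downVec_mem_belowGraph {f : E d → ℝ} {L : ℝ≥0}
    (hf : LipschitzOnWith L f (openCube d)) {x : E (d + 1)} (hx : x ∈ belowGraph f) {z : E d}
    {h : ℝ} (hz : horiz x + z ∈ openCube d) (hh : L * ‖z‖ ≤ h) {t : ℝ}
    (ht : t ∈ Set.Icc (0 : ℝ) 1) : x + t • downVec z h ∈ belowGraph f := by
  have h1 : horiz x + t • z ∈ openCube d := by
    have := convex_openCube.add_smul_sub_mem hx.1 hz ht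
    rwa [add_sub_cancel_left] at this
  have h2 := hf.dist_le_mul _ hx.1 _ h1
  rw [dist_self_add_right, Real.dist_eq, norm_smul, Real.norm_of_nonneg ht.1] at h2
  have h3 := (le_abs_self _).trans h2
  refine ⟨by rwa [horiz_add_smul, horiz_downVec], ?_⟩
  rw [horiz_add_smul, horiz_downVec]
  simp only [PiLp.add_apply, PiLp.smul_apply, downVec_last, smul_eq_mul]
  nlinarith [hx.2, mul_le_mul_of_nonneg_left hh ht.1]

/-- The points whose `j`-th horizontal coordinate is away from `1` if `σ j` holds, and away from
`0` otherwise. -/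
def sector (σ : Fin d → Bool) : Set (E (d + 1)) :=
  {x | ∀ j : Fin d, if σ j then x j.castSucc < 2 / 3 else 1 / 3 < x j.castSucc}

lemma isOpen_sector (σ : Fin d → Bool) : IsOpen (sector σ) := by
  have : sector σ = ⋂ j : Fin d, {x : E (d + 1) |
      if σ j then x j.castSucc < 2 / 3 else 1 / 3 < x j.castSucc} := by
    ext y; simp [sector]
  rw [this]
  refine isOpen_iInter_of_finite fun j => ?_
  have h : Continuous fun x : E (d + 1) => x j.castSucc := by fun_prop
  cases hσ : σ j
  · simpa using isOpen_lt continuous_const h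
  · simpa using isOpen_lt h continuous_const

lemma exists_mem_sector (x : E (d + 1)) : ∃ σ, x ∈ sector σ := by
  refine ⟨fun j => decide (x j.castSucc < 2 / 3), fun j => ?_⟩
  by_cases h : x j.castSucc < 2 / 3
  · simp [h]
  · simp only [h, decide_false, Bool.false_eq_true, if_false]
    linarith

/-- The inward step in the `j`-th direction for the sector `σ`. -/
def sectorStep (δ : ℝ) (σ : Fin d → Bool) (j : Fin d) : ℝ := if σ j then δ else -δ

lemma abs_sectorStep {δ : ℝ} (hδ : 0 < δ) (σ : Fin d → Bool) (j : Fin d) :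
    |sectorStep δ σ j| = δ := by
  unfold sectorStep
  split_ifs <;> simp [abs_of_pos hδ]

/-- In a sector each coordinate has room of more than `1 / 3` on the side of the step. -/
lemma horiz_add_single_mem_openCube {δ : ℝ} (hδ : 0 < δ) (hδ3 : δ ≤ 1 / 3) {σ : Fin d → Bool}
    {x : E (d + 1)} (hx : horiz x ∈ openCube d) (hxσ : x ∈ sector σ) (j : Fin d) :
    horiz x + EuclideanSpace.single j (sectorStep δ σ j) ∈ openCube d := by
  intro i
  have h1 := hx i
  have h2 := hxσ i
  by_cases hij : i = j
  · subst hij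
    simp only [PiLp.add_apply, PiLp.single_apply, if_true, sectorStep, horiz_apply] at h1 h2 ⊢
    split_ifs at h2 ⊢ <;> constructor <;> linarith
  · simpa [hij] using h1

lemma lintegral_comp_add_le {n : ℕ} {A D : Set (E n)} (hA : MeasurableSet A) (hD : MeasurableSet D)
    (v : E n) (h : ∀ x ∈ A, x + v ∈ D) (g : E n → ℝ≥0∞) :
    ∫⁻ x in A, g (x + v) ≤ ∫⁻ x in D, g x := by
  rw [← lintegral_indicator hA, ← lintegral_indicator hD, ← lintegral_add_right_eq_self (D.indicator g) v]
  refine lintegral_mono fun x => ?_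
  by_cases hx : x ∈ A
  · rw [Set.indicator_of_mem hx, Set.indicator_of_mem (h x hx)]
  · rw [Set.indicator_of_notMem hx]
    exact zero_le

/-- A function is controlled on `A` by its values on a translate of `A` and its differences. -/
lemma lintegral_le_of_translate {n : ℕ} {A D : Set (E n)} (hA : MeasurableSet A)
    (hD : MeasurableSet D) {w : E n → ℝ} (hw : StronglyMeasurable w) {v : E n} {T : ℝ≥0∞}
    (hAD : ∀ x ∈ A, x + v ∈ D) (hT : ∫⁻ x in A, ‖w (x + v) - w x‖ₑ ^ 2 ≤ T) :
    ∫⁻ x in A, ‖w x‖ₑ ^ 2 ≤ 2 * T + 2 * ∫⁻ x in D, ‖w x‖ₑ ^ 2 := by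
  have hwm := hw.measurable
  calc ∫⁻ x in A, ‖w x‖ₑ ^ 2
      ≤ ∫⁻ x in A, (2 * ‖w (x + v) - w x‖ₑ ^ 2 + 2 * ‖w (x + v)‖ₑ ^ 2) := by
        refine lintegral_mono fun x => ?_
        have h := enorm_add_sq_le (-(w (x + v) - w x)) (w (x + v))
        rwa [enorm_neg, neg_sub, sub_add_cancel] at h
    _ = 2 * (∫⁻ x in A, ‖w (x + v) - w x‖ₑ ^ 2) + 2 * ∫⁻ x in A, ‖w (x + v)‖ₑ ^ 2 := by
        rw [lintegral_add_left (by fun_prop), lintegral_const_mul _ (by fun_prop),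
          lintegral_const_mul _ (by fun_prop)]
    _ ≤ _ := by
        exact add_le_add (mul_le_mul_right hT _) (mul_le_mul_right
          (lintegral_comp_add_le hA hD v hAD fun x => ‖w x‖ₑ ^ 2) _)

/-- A vector field is controlled on `A` by its values on a set in which the translates of `A` in
`d + 1` independent directions lie, and its longitudinal differences in these directions. -/
lemma lintegral_le_of_downVec {A D : Set (E (d + 1))} (hA : MeasurableSet A)
    (hD : MeasurableSet D) {U : E (d + 1) → E (d + 1)} (hU : StronglyMeasurable U)
    {h δ : ℝ} {R : ℝ≥0} {s : Fin d → ℝ} (hδ : 0 < δ) (hδh : δ ≤ h) (hR : δ + h ≤ R)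
    (hs : ∀ j, |s j| = δ) {T : ℝ≥0∞} {Z : Set (E d)}
    (hZ : Z = insert 0 (Set.range fun j => EuclideanSpace.single j (s j)))
    (hAD : ∀ z ∈ Z, ∀ x ∈ A, x + downVec z h ∈ D)
    (hT : ∀ z ∈ Z, ∫⁻ x in A, ‖(inner ℝ (downVec z h) (U (x + downVec z h)) -
      inner ℝ (downVec z h) (U x) : ℝ)‖ₑ ^ 2 ≤ T) :
    ∫⁻ x in A, ‖U x‖ₑ ^ 2 ≤ ‖δ⁻¹‖ₑ ^ 2 * (4 * d + 1) *
      (2 * T + 2 * (R ^ 2 * ∫⁻ x in D, ‖U x‖ₑ ^ 2)) := by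
  have hUm := hU.measurable
  have hnorm : ∀ z ∈ Z, ‖downVec z h‖ₑ ≤ R := by
    intro z hz
    have h1 : ‖z‖ ≤ δ := by
      rw [hZ] at hz
      rcases hz with rfl | ⟨j, rfl⟩
      · simpa using hδ.le
      · simp [hs]
    rw [enorm_eq_nnnorm]
    refine ENNReal.coe_le_coe.2 (NNReal.coe_le_coe.1 ?_)
    exact (norm_downVec_le (by linarith)).trans (by linarith)
  set T' : ℝ≥0∞ := 2 * T + 2 * (R ^ 2 * ∫⁻ x in D, ‖U x‖ₑ ^ 2) with hT'
  set p : E d → E (d + 1) → ℝ≥0∞ := fun z x => ‖(inner ℝ (downVec z h) (U x) : ℝ)‖ₑ ^ 2 with hp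
  have hpm : ∀ z, Measurable (p z) := fun z =>
    ((measurable_const.inner hUm).enorm).pow_const 2
  have hpT : ∀ z ∈ Z, ∫⁻ x in A, p z x ≤ T' := by
    intro z hz
    refine (lintegral_le_of_translate (w := fun x => inner ℝ (downVec z h) (U x)) hA hD
      (measurable_const.inner hUm).stronglyMeasurable (hAD z hz) (hT z hz)).trans ?_
    rw [hT']
    gcongr
    rw [← lintegral_const_mul' _ _ (by simp)]
    refine lintegral_mono fun x => ?_
    rw [← mul_pow]
    gcongr
    refine le_trans ?_ (mul_le_mul_left (hnorm z hz) _)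
    simp only [← ofReal_norm]
    rw [← ENNReal.ofReal_mul (norm_nonneg _)]
    exact ENNReal.ofReal_le_ofReal (norm_inner_le_norm _ _)
  have h0 : (0 : E d) ∈ Z := by rw [hZ]; exact Set.mem_insert _ _
  have hj : ∀ j, EuclideanSpace.single j (s j) ∈ Z := fun j => by
    rw [hZ]; exact Set.mem_insert_of_mem _ ⟨j, rfl⟩
  have hlast : ∀ x, ‖U x (Fin.last d)‖ₑ ^ 2 ≤ ‖δ⁻¹‖ₑ ^ 2 * p 0 x := by
    intro x
    -- The purely vertical vector recovers the last component; below, its difference with a tilted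
    -- vector is `s j` times a horizontal unit vector and recovers component `j`.
    have : U x (Fin.last d) = -h⁻¹ * inner ℝ (downVec 0 h) (U x) := by
      rw [inner_downVec]
      have : h ≠ 0 := by linarith
      field_simp
      simp
    rw [this, enorm_mul, mul_pow, enorm_neg]
    gcongr
    simp only [← ofReal_norm, norm_inv]
    refine ENNReal.ofReal_le_ofReal ?_
    rw [Real.norm_of_nonneg hδ.le, Real.norm_of_nonneg (hδ.le.trans hδh)]
    gcongr
  have hcast : ∀ x j, ‖U x (Fin.castSucc j)‖ₑ ^ 2 ≤
      ‖δ⁻¹‖ₑ ^ 2 * (2 * p (EuclideanSpace.single j (s j)) x + 2 * p 0 x) := by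
    intro x j
    have hsj : s j ≠ 0 := fun h => by
      have := hs j
      rw [h, abs_zero] at this
      linarith
    have : U x j.castSucc = (s j)⁻¹ * (inner ℝ (downVec (EuclideanSpace.single j (s j)) h) (U x) +
        -inner ℝ (downVec 0 h) (U x)) := by
      rw [inner_downVec, inner_downVec]
      simp [PiLp.single_apply, ite_mul, hsj]
    rw [this, enorm_mul, mul_pow]
    have h1 : ‖(s j)⁻¹‖ₑ = ‖δ⁻¹‖ₑ := by
      simp only [← ofReal_norm, norm_inv, Real.norm_eq_abs, hs j, abs_of_pos hδ]
    rw [h1]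
    gcongr
    refine (enorm_add_sq_le _ _).trans ?_
    rw [enorm_neg]
  calc ∫⁻ x in A, ‖U x‖ₑ ^ 2
      ≤ ∫⁻ x in A, ((∑ j, ‖δ⁻¹‖ₑ ^ 2 * (2 * p (EuclideanSpace.single j (s j)) x + 2 * p 0 x)) +
          ‖δ⁻¹‖ₑ ^ 2 * p 0 x) := by
        refine lintegral_mono fun x => ?_
        rw [enorm_sq_eq_sum, Fin.sum_univ_castSucc]
        gcongr with j
        · exact hcast x j
        · exact hlast x
    _ = (∑ j, ‖δ⁻¹‖ₑ ^ 2 * (2 * (∫⁻ x in A, p (EuclideanSpace.single j (s j)) x) +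
          2 * ∫⁻ x in A, p 0 x)) + ‖δ⁻¹‖ₑ ^ 2 * ∫⁻ x in A, p 0 x := by
        rw [lintegral_add_right _ (by fun_prop), lintegral_const_mul _ (hpm 0),
          lintegral_finsetSum _ fun j _ => by fun_prop]
        congr 1
        refine Finset.sum_congr rfl fun j _ => ?_
        rw [lintegral_const_mul _ (by fun_prop), lintegral_add_left (by fun_prop),
          lintegral_const_mul _ (hpm _), lintegral_const_mul _ (hpm _)]
    _ ≤ (∑ _j : Fin d, ‖δ⁻¹‖ₑ ^ 2 * (2 * T' + 2 * T')) + ‖δ⁻¹‖ₑ ^ 2 * T' := by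
        gcongr with j
        · exact hpT _ (hj j)
        · exact hpT _ h0
        · exact hpT _ h0
    -- Each of the `d` horizontal components costs `2 + 2`, the vertical one `1`.
    _ = ‖δ⁻¹‖ₑ ^ 2 * (4 * d + 1) * T' := by
        simp only [Finset.sum_const, Finset.card_univ, Fintype.card_fin, nsmul_eq_mul]
        ring

lemma lintegral_le_card_mul_of_cover {α ι : Type*} [MeasurableSpace α] {μ : Measure α} [Fintype ι]
    {S : Set α} {A : ι → Set α} (hS : S ⊆ ⋃ i, A i) {φ : α → ℝ≥0∞} {c : ℝ≥0∞}
    (h : ∀ i, ∫⁻ x in A i, φ x ∂μ ≤ c) : ∫⁻ x in S, φ x ∂μ ≤ Fintype.card ι * c := by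
  refine (lintegral_mono_set hS).trans ((lintegral_iUnion_le _ _).trans ?_)
  rw [tsum_fintype]
  exact (Finset.sum_le_card_nsmul _ _ _ fun i _ => h i).trans (by simp)

/-- The part of the slab `h < x_N < h + 1` of `Q_f` in the sector `σ`. -/
def slabPiece (f : E d → ℝ) (σ : Fin d → Bool) (h : ℝ) : Set (E (d + 1)) :=
  {x | x ∈ belowGraph f ∩ sector σ ∧ h < x (Fin.last d) ∧ x (Fin.last d) < h + 1}

lemma isOpen_slabPiece {f : E d → ℝ} (hf : ContinuousOn f (openCube d)) (σ : Fin d → Bool)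
    (h : ℝ) : IsOpen (slabPiece f σ h) := by
  have hc : Continuous fun x : E (d + 1) => x (Fin.last d) := by fun_prop
  exact ((isOpen_belowGraph hf).inter (isOpen_sector σ)).inter
    ((isOpen_lt continuous_const hc).inter (isOpen_lt hc continuous_const))

/-- The slabs have unit height and start at the half-integers `1/2, 1, 3/2, …`, so they overlap.
Each descends exactly onto the height range of the unit cube, and `h ≥ 1 / 2` leaves room for a
horizontal step of fixed size. -/
lemma openQ_subset_cover {f : E d → ℝ} {M : ℝ} (hfM : ∀ y ∈ openCube d, f y ≤ M) :
    openQ f ⊆ openCube (d + 1) ∪ ⋃ i : (Fin d → Bool) × Fin ⌈2 * M⌉₊,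
      slabPiece f i.1 (((i.2 : ℕ) + 1) / 2) := by
  intro x hx
  rcases lt_or_ge (x (Fin.last d)) 1 with h | h
  · left
    exact Fin.lastCases ⟨hx.2, h⟩ fun j => hx.1.1 j
  · right
    obtain ⟨σ, hσ⟩ := exists_mem_sector x
    have h1 := Nat.floor_le (a := 2 * x (Fin.last d)) (by linarith)
    have h2 := Nat.lt_floor_add_one (2 * x (Fin.last d))
    -- With `⌊2 x_N⌋ = k + 2` and `h = (k + 1) / 2`, one has `h + 1 / 2 ≤ x_N < h + 1`.
    have h3 : 2 ≤ ⌊2 * x (Fin.last d)⌋₊ := Nat.le_floor (by push_cast; linarith)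
    obtain ⟨k, hk⟩ := Nat.exists_eq_add_of_le h3
    rw [hk] at h1 h2
    push_cast at h1 h2
    have h4 : k < ⌈2 * M⌉₊ := by
      rw [Nat.lt_ceil]
      linarith [hx.1.2, hfM _ hx.1.1]
    refine Set.mem_iUnion.2 ⟨(σ, ⟨k, h4⟩), ⟨hx.1, hσ⟩, ?_, ?_⟩ <;> dsimp only <;> linarith

lemma lintegral_openQ_le {f : E d → ℝ} {M : ℝ} (hfM : ∀ y ∈ openCube d, f y ≤ M)
    {φ : E (d + 1) → ℝ≥0∞} {b c : ℝ≥0∞} (hb : ∫⁻ x in openCube (d + 1), φ x ≤ b)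
    (hc : ∀ σ h, 1 / 2 ≤ h → h ≤ M + 1 → ∫⁻ x in slabPiece f σ h, φ x ≤ c) :
    ∫⁻ x in openQ f, φ x ≤ b + Fintype.card ((Fin d → Bool) × Fin ⌈2 * M⌉₊) * c := by
  refine (lintegral_mono_set (openQ_subset_cover hfM)).trans ((lintegral_union_le _ _ _).trans ?_)
  refine add_le_add hb (lintegral_le_card_mul_of_cover subset_rfl fun i => hc _ _ ?_ ?_)
  · linarith [Nat.cast_nonneg (α := ℝ) (i.2 : ℕ)]
  · have h1 := i.2.2
    rw [Nat.lt_ceil] at h1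
    linarith

lemma add_smul_downVec_mem_openQ {f : E d → ℝ} {L : ℝ≥0}
    (hf : LipschitzOnWith L f (openCube d)) {σ : Fin d → Bool} {x : E (d + 1)} {z : E d}
    {h : ℝ} (hx : x ∈ slabPiece f σ h) (hz : horiz x + z ∈ openCube d) (hh : L * ‖z‖ ≤ h) {t : ℝ}
    (ht : t ∈ Set.Icc (0 : ℝ) 1) : x + t • downVec z h ∈ openQ f := by
  refine ⟨add_smul_downVec_mem_belowGraph hf hx.1.1 hz hh ht, ?_⟩
  have h0 : 0 ≤ h := le_trans (by positivity) hh
  simp only [PiLp.add_apply, PiLp.smul_apply, downVec_last, smul_eq_mul]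
  nlinarith [hx.2.1, ht.1, ht.2]

lemma add_downVec_mem_openCube {f : E d → ℝ} {σ : Fin d → Bool} {x : E (d + 1)} {z : E d}
    {h : ℝ} (hx : x ∈ slabPiece f σ h) (hz : horiz x + z ∈ openCube d) :
    x + downVec z h ∈ openCube (d + 1) := by
  refine Fin.lastCases ?_ fun j => ?_
  · simp only [PiLp.add_apply, downVec_last]
    constructor <;> linarith [hx.2.1, hx.2.2]
  · simpa using hz j

end Spreading

/-! ### The four inequalities. -/

section Main

lemma lintegral_sq_extension {α F : Type*} [MeasurableSpace α] [NormedAddCommGroup F]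
    {μ : Measure α} {S S' : Set α} (hSS : S' =ᵐ[μ] S) {u w : α → F}
    (hw0 : ∀ x ∉ S', w x = 0) (hwu : w =ᵐ[μ.restrict S] u) :
    ∫⁻ x, ‖w x‖ₑ ^ 2 ∂μ = ∫⁻ x in S, ‖u x‖ₑ ^ 2 ∂μ := by
  rw [← setLIntegral_eq_of_support_subset (s := S') (f := fun x => ‖w x‖ₑ ^ 2),
    Measure.restrict_congr_set hSS]
  · apply lintegral_congr_ae
    filter_upwards [hwu] with x hx
    rw [hx]
  · intro x hx
    by_contra h
    exact hx (by simp [hw0 x h])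

/-- Pythagoras: `‖u - r‖² = ‖u‖² + ‖r‖²`. -/
lemma lintegral_sq_le_of_integral_inner_eq_zero {α F : Type*} [MeasurableSpace α]
    [NormedAddCommGroup F] [InnerProductSpace ℝ F] {μ : Measure α} {u r : α → F}
    (hu : MemLp u 2 μ) (hr : MemLp r 2 μ) (h : ∫ x, inner ℝ (u x) (r x) ∂μ = 0) :
    ∫⁻ x, ‖u x‖ₑ ^ 2 ∂μ ≤ ∫⁻ x, ‖u x - r x‖ₑ ^ 2 ∂μ := by
  have h0 : inner ℝ (hu.toLp u) (hr.toLp r) = (0 : ℝ) := by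
    rw [L2.inner_def, ← h]
    apply integral_congr_ae
    filter_upwards [hu.coeFn_toLp, hr.coeFn_toLp] with x h1 h2
    rw [h1, h2]
  have h1 := norm_sub_sq_real (hu.toLp u) (hr.toLp r)
  rw [h0, mul_zero, sub_zero, ← MemLp.toLp_sub, Lp.norm_toLp, Lp.norm_toLp, Lp.norm_toLp] at h1
  rw [← sq_eLpNorm_two, ← sq_eLpNorm_two (fun x => u x - r x)]
  gcongr
  change _ ≤ eLpNorm (u - r) 2 μ
  rw [← ENNReal.toReal_le_toReal hu.2.ne (hu.sub hr).2.ne]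
  refine (sq_le_sq₀ ENNReal.toReal_nonneg ENNReal.toReal_nonneg).1 ?_
  nlinarith [sq_nonneg (eLpNorm r 2 μ).toReal]

variable {d : ℕ}

/-- An admissible profile. -/
structure IsProfile (L : ℝ≥0) (M : ℝ) (f : E d → ℝ) : Prop where
  lip : LipschitzOnWith L f (openCube d)
  bounds : ∀ y ∈ openCube d, 1 ≤ f y ∧ f y ≤ M

variable {L : ℝ≥0} {M : ℝ} {f : E d → ℝ}

lemma IsProfile.continuousOn (hf : IsProfile L M f) : ContinuousOn f (openCube d) :=
  hf.lip.continuousOn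

lemma IsProfile.volume_lt_top (hf : IsProfile L M f) (hM : 1 < M) : volume (openQ f) < ⊤ :=
  volume_openQ_lt_top hM.le fun y hy => (hf.bounds y hy).2

lemma IsProfile.openCube_subset (hf : IsProfile L M f) : openCube (d + 1) ⊆ openQ f :=
  fun _ hx => ⟨⟨fun j => hx j.castSucc, (hx (Fin.last d)).2.trans_le
    (hf.bounds _ fun j => hx j.castSucc).1⟩, (hx (Fin.last d)).1⟩

lemma IsProfile.memLp_of_continuous (hf : IsProfile L M f) (hM : 1 < M) {F : Type*}
    [NormedAddCommGroup F] {r : E (d + 1) → F} (hr : Continuous r) :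
    MemLp r 2 (volume.restrict (Q f)) := by
  rw [← Measure.restrict_congr_set (openQ_ae_eq hf.continuousOn)]
  have : IsFiniteMeasure (volume.restrict (openQ f)) := ⟨by simpa using hf.volume_lt_top hM⟩
  obtain ⟨K, hK⟩ := (isCompact_closedBall (0 : E (d + 1))
    ((d + 1 : ℕ) * M)).exists_bound_of_continuousOn hr.continuousOn
  refine MemLp.of_bound hr.aestronglyMeasurable K ?_
  filter_upwards [ae_restrict_mem (isOpen_openQ hf.continuousOn).measurableSet] with x hx
  refine hK x ?_
  rw [mem_closedBall_zero_iff]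
  exact norm_le_of_forall_abs_le
    (abs_coord_le_of_mem_openQ hM.le (fun y hy => (hf.bounds y hy).2) hx)

/-- The representation of a scalar function and its gradient by global functions. -/
lemma IsProfile.exists_scalar_extension (hf : IsProfile L M f) (hM : 1 < M)
    {u : E (d + 1) → ℝ} {g : E (d + 1) → E (d + 1)} (hu : IsH1 (Q f) u g) :
    ∃ w : E (d + 1) → ℝ, StronglyMeasurable w ∧ Integrable w ∧ (∀ x ∉ openQ f, w x = 0) ∧
      w =ᵐ[volume.restrict (Q f)] u ∧
      ∀ Ω : Set (E (d + 1)), (∀ φ, IsTestFunction Ω φ → ∀ i,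
        ∫ x in Q f, u x * partialDeriv i φ x = -∫ x in Q f, g x i * φ x) →
      ∀ v, ∀ A, IsOpen A → (∀ x ∈ A, ∀ t ∈ Set.Icc (0 : ℝ) 1, x + t • v ∈ Ω) →
        ∫⁻ x in A, ‖w (x + v) - w x‖ₑ ^ 2 ≤ ‖v‖ₑ ^ 2 * ∫⁻ x in Q f, ‖g x‖ₑ ^ 2 := by
  have hQ := openQ_ae_eq hf.continuousOn
  have hm := (isOpen_openQ hf.continuousOn).measurableSet
  obtain ⟨w, hw, hw2, hwi, hw0, hwu⟩ := exists_extension hm hQ (hf.volume_lt_top hM) hu.1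
  obtain ⟨g', -, hg2, -, hg0, hgu⟩ := exists_extension hm hQ (hf.volume_lt_top hM) hu.2.1
  refine ⟨w, hw, hwi, hw0, hwu, fun Ω hΩ v A hA hAΩ => ?_⟩
  rw [← lintegral_sq_extension hQ hg0 hgu]
  refine HasWeakGrad.lintegral_translate_sub_le (Ω := Ω) (fun φ hφ i => ?_) hA hwi hw2 hg2 v hAΩ
  rw [integral_mul_extension hQ hw0 hwu, hΩ φ hφ i,
    integral_mul_extension hQ (u := fun x => g x i) (fun x hx => by rw [hg0 x hx]; rfl)
      (hgu.mono fun x hx => by simp only [hx])]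

/-- The representation of a vector field and its gradient by global functions. -/
lemma IsProfile.exists_vector_extension (hf : IsProfile L M f) (hM : 1 < M)
    {u : E (d + 1) → E (d + 1)} {G : Fin (d + 1) → E (d + 1) → E (d + 1)}
    (hu : IsH1Vec (Q f) u G) :
    MemLp u 2 (volume.restrict (Q f)) ∧
    ∃ U : E (d + 1) → E (d + 1), StronglyMeasurable U ∧ Integrable U ∧
      (∀ x ∉ openQ f, U x = 0) ∧ U =ᵐ[volume.restrict (Q f)] u ∧
      ∀ Ω : Set (E (d + 1)), (∀ φ, IsTestFunction Ω φ → ∀ i j,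
        ∫ x in Q f, u x i * partialDeriv j φ x = -∫ x in Q f, G i x j * φ x) →
      ∀ v, ∀ A, IsOpen A → (∀ x ∈ A, ∀ t ∈ Set.Icc (0 : ℝ) 1, x + t • v ∈ Ω) →
        ∫⁻ x in A, ‖(inner ℝ v (U (x + v)) - inner ℝ v (U x) : ℝ)‖ₑ ^ 2 ≤
          ‖v‖ₑ ^ 4 * ∫⁻ x in Q f, ‖symGrad G x‖ₑ ^ 2 := by
  have hQ := openQ_ae_eq hf.continuousOn
  have hm := (isOpen_openQ hf.continuousOn).measurableSet
  have hu2 : MemLp u 2 (volume.restrict (Q f)) :=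
    MemLp.of_eval_piLp fun i => (hu i).1
  refine ⟨hu2, ?_⟩
  obtain ⟨U, hU, hU2, hUi, hU0, hUu⟩ := exists_extension hm hQ (hf.volume_lt_top hM) hu2
  choose G' hG' hG2 hGi hG0 hGu using fun i =>
    exists_extension hm hQ (hf.volume_lt_top hM) (hu i).2.1
  refine ⟨U, hU, hUi, hU0, hUu, fun Ω hΩ v A hA hAΩ => ?_⟩
  have hs0 : ∀ x ∉ openQ f, symGrad G' x = 0 := fun x hx => by
    ext p
    simp [symGrad, hG0 _ x hx]
  have hsu : symGrad G' =ᵐ[volume.restrict (Q f)] symGrad G := by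
    filter_upwards [ae_all_iff.2 hGu] with x hx
    simp [symGrad, hx]
  rw [← lintegral_sq_extension hQ hs0 hsu]
  refine lintegral_inner_translate_sub_le (Ω := Ω) (fun i φ hφ j => ?_) hA hUi hU2 hG2 v hAΩ
  rw [integral_mul_extension hQ (u := fun x => u x i) (fun x hx => by rw [hU0 x hx]; rfl)
    (hUu.mono fun x hx => by simp only [hx]), hΩ φ hφ i j,
    integral_mul_extension hQ (u := fun x => G i x j) (fun x hx => by rw [hG0 i x hx]; rfl)
    ((hGu i).mono fun x hx => by simp only [hx])]

lemma enorm_downVec_le {z : E d} {h : ℝ} (hh : 0 ≤ h) {R : ℝ≥0} (hR : ‖z‖ + h ≤ R) :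
    ‖downVec z h‖ₑ ≤ R := by
  rw [enorm_eq_nnnorm]
  exact ENNReal.coe_le_coe.2 (NNReal.coe_le_coe.1 ((norm_downVec_le hh).trans hR))

lemma lintegral_Q_eq {F : Type*} [NormedAddCommGroup F] (hf : IsProfile L M f)
    {u w : E (d + 1) → F} (r : E (d + 1) → F) (hwu : w =ᵐ[volume.restrict (Q f)] u) :
    ∫⁻ x in Q f, ‖u x - r x‖ₑ ^ 2 = ∫⁻ x in openQ f, ‖w x - r x‖ₑ ^ 2 := by
  rw [Measure.restrict_congr_set (openQ_ae_eq hf.continuousOn)]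
  apply lintegral_congr_ae
  filter_upwards [hwu] with x hx
  rw [hx]

lemma setLIntegral_compl_eq_zero {F : Type*} [NormedAddCommGroup F] (hf : IsProfile L M f)
    {w : E (d + 1) → F} (hw : ∀ x ∉ openQ f, w x = 0) :
    ∫⁻ x in (openQ f)ᶜ, ‖w x‖ₑ ^ 2 = 0 := by
  rw [← lintegral_indicator (isOpen_openQ hf.continuousOn).measurableSet.compl]
  refine (lintegral_congr fun x => ?_).trans lintegral_zero
  refine Set.indicator_apply_eq_zero.2 fun hx => ?_
  simp [hw x hx]

/-- The Poincaré inequality for functions vanishing on the base. -/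
lemma poincare_zero_trace (d : ℕ) (L : ℝ≥0) (M : ℝ) (hM : 1 < M) : ∃ c : ℝ≥0,
    ∀ f : E d → ℝ, IsProfile L M f → ∀ (u : E (d + 1) → ℝ) (g : E (d + 1) → E (d + 1)),
      IsH1 (Q f) u g → HasBaseTrace f u g 0 →
      ∫⁻ x in Q f, ‖u x‖ₑ ^ 2 ≤ c * ∫⁻ x in Q f, ‖g x‖ₑ ^ 2 := by
  refine ⟨2 * M.toNNReal ^ 2, fun f hf u g hu h0 => ?_⟩
  obtain ⟨w, hw, -, hw0, hwu, hT⟩ := hf.exists_scalar_extension hM hu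
  have hA := isOpen_belowGraph hf.continuousOn
  have h1 := hT (belowGraph f) (fun φ hφ i => h0.integral_mul_partialDeriv hf.continuousOn hu hφ i)
    (downVec 0 M) _ hA fun x hx t ht => add_smul_downVec_mem_belowGraph hf.lip hx
      (by simpa using hx.1) (by simp; linarith) ht
  have hMe : ‖downVec (0 : E d) M‖ₑ ≤ M.toNNReal :=
    enorm_downVec_le (by linarith) (by simp)
  -- A descent by `M ≥ f` ends below the base, where `w = 0`, so only the difference term survives.
  have h2 := lintegral_le_of_translate (D := (openQ f)ᶜ) hA.measurableSet
    (isOpen_openQ hf.continuousOn).measurableSet.compl hw (fun x hx hQ => ?_) h1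
  · have h3 := lintegral_Q_eq hf (fun _ => 0) hwu
    simp only [sub_zero] at h3
    rw [h3]
    refine (lintegral_mono_set fun x hx => hx.1).trans (h2.trans ?_)
    rw [setLIntegral_compl_eq_zero hf hw0, mul_zero, add_zero]
    push_cast
    rw [mul_assoc]
    gcongr
  · have h4 := hQ.2
    simp only [PiLp.add_apply, downVec_last] at h4
    linarith [hx.2, (hf.bounds _ hx.1).2]

/-- The Korn inequality for fields vanishing on the base. -/
lemma korn_zero_trace (d : ℕ) (L : ℝ≥0) (M : ℝ) (hM : 1 < M) : ∃ c : ℝ≥0,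
    ∀ f : E d → ℝ, IsProfile L M f →
      ∀ (u : E (d + 1) → E (d + 1)) (G : Fin (d + 1) → E (d + 1) → E (d + 1)),
      IsH1Vec (Q f) u G → (∀ i, HasBaseTrace f (fun x => u x i) (G i) 0) →
      ∫⁻ x in Q f, ‖u x‖ₑ ^ 2 ≤ c * ∫⁻ x in Q f, ‖symGrad G x‖ₑ ^ 2 := by
  -- Chosen so that `δ ≤ 1 / 3`, the margin of the sectors, and `L δ ≤ 1 ≤ M`, as the descent by `M`
  -- requires.
  set δ : ℝ := 1 / (L + 3) with hδ
  have hL := L.coe_nonneg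
  have hδp : 0 < δ := by positivity
  have hδ3 : δ ≤ 1 / 3 := one_div_le_one_div_of_le (by norm_num) (by linarith)
  have hLδ : L * δ ≤ M := by
    have : L * δ ≤ 1 := by
      rw [hδ, mul_one_div, div_le_one (by positivity)]
      linarith
    linarith
  set R : ℝ≥0 := (δ + M).toNNReal with hR
  have hRe : δ + M ≤ R := Real.le_coe_toNNReal _
  set c : ℝ≥0∞ := Fintype.card (Fin d → Bool) * (‖δ⁻¹‖ₑ ^ 2 * (4 * d + 1) * (2 * R ^ 4)) with hc
  have hct : c ≠ ⊤ := by finiteness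
  refine ⟨c.toNNReal, fun f hf u G hu h0 => ?_⟩
  rw [ENNReal.coe_toNNReal hct]
  obtain ⟨-, U, hU, -, hU0, hUu, hT⟩ := hf.exists_vector_extension hM hu
  have h3 := lintegral_Q_eq hf (fun _ => 0) hUu
  simp only [sub_zero] at h3
  rw [h3, hc, mul_assoc]
  refine lintegral_le_card_mul_of_cover (A := fun σ => belowGraph f ∩ sector σ) (fun x hx => ?_)
    fun σ => ?_
  · obtain ⟨σ, hσ⟩ := exists_mem_sector x
    exact Set.mem_iUnion.2 ⟨σ, hx.1, hσ⟩
  have hA := (isOpen_belowGraph hf.continuousOn).inter (isOpen_sector σ)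
  have hZ : ∀ z ∈ insert (0 : E d) (Set.range fun j => EuclideanSpace.single j (sectorStep δ σ j)),
      ‖z‖ ≤ δ ∧ ∀ x ∈ belowGraph f ∩ sector σ, horiz x + z ∈ openCube d := by
    rintro z (rfl | ⟨j, rfl⟩)
    · exact ⟨by simpa using hδp.le, fun x hx => by simpa using hx.1.1⟩
    · exact ⟨by simp [abs_sectorStep hδp],
        fun x hx => horiz_add_single_mem_openCube hδp hδ3 hx.1.1 hx.2 j⟩
  have h2 := lintegral_le_of_downVec (D := (openQ f)ᶜ)
    (T := R ^ 4 * ∫⁻ x in Q f, ‖symGrad G x‖ₑ ^ 2) hA.measurableSet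
    (isOpen_openQ hf.continuousOn).measurableSet.compl hU hδp (by linarith) hRe
    (fun j => abs_sectorStep hδp σ j) rfl (fun z _ x hx hQ => ?_) (fun z hz => ?_)
  · refine h2.trans (le_of_eq ?_)
    rw [setLIntegral_compl_eq_zero hf hU0]
    ring
  · have h4 := hQ.2
    simp only [PiLp.add_apply, downVec_last] at h4
    linarith [hx.1.2, (hf.bounds _ hx.1.1).2]
  · refine (hT (belowGraph f) (fun φ hφ i j => (h0 i).integral_mul_partialDeriv hf.continuousOn
      (hu i) hφ j) (downVec z M) _ hA fun x hx t ht => add_smul_downVec_mem_belowGraph hf.lip hx.1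
      ((hZ z hz).2 x hx) ?_ ht).trans ?_
    · exact (mul_le_mul_of_nonneg_left (hZ z hz).1 hL).trans hLδ
    · gcongr
      exact enorm_downVec_le (by linarith) (by linarith [(hZ z hz).1])

/-- The Poincaré inequality for functions of zero mean. -/
lemma poincare_zero_mean (d : ℕ) (L : ℝ≥0) (M : ℝ) (hM : 1 < M) : ∃ c : ℝ≥0,
    ∀ f : E d → ℝ, IsProfile L M f → ∀ (u : E (d + 1) → ℝ) (g : E (d + 1) → E (d + 1)),
      IsH1 (Q f) u g → ∫ x in Q f, u x = 0 →
      ∫⁻ x in Q f, ‖u x‖ₑ ^ 2 ≤ c * ∫⁻ x in Q f, ‖g x‖ₑ ^ 2 := by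
  obtain ⟨c₀, hc₀⟩ := exists_const_approx (d + 1)
  -- `R` bounds both the descents `h ≤ M + 1` and the differences of points of the cube.
  set R : ℝ≥0 := (M + 1).toNNReal + (d + 1 : ℕ) with hR
  have hRM : M + 1 ≤ R := by
    rw [hR]; push_cast
    linarith [Real.le_coe_toNNReal (M + 1)]
  have hRd : ((d + 1 : ℕ) : ℝ) ≤ R := by
    rw [hR]; push_cast
    linarith [(M + 1).toNNReal.coe_nonneg]
  set m : ℕ := Fintype.card ((Fin d → Bool) × Fin ⌈2 * M⌉₊) with hm
  refine ⟨(c₀ + m * (2 + 2 * c₀)) * R ^ 2, fun f hf u g hu h0 => ?_⟩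
  obtain ⟨w, hw, hwi, -, hwu, hT⟩ := hf.exists_scalar_extension hM hu
  set N := ∫⁻ x in Q f, ‖g x‖ₑ ^ 2 with hN
  have hT' : ∀ v, ‖v‖ₑ ≤ R → ∀ A, IsOpen A → (∀ x ∈ A, ∀ t ∈ Set.Icc (0 : ℝ) 1,
      x + t • v ∈ openQ f) → ∫⁻ x in A, ‖w (x + v) - w x‖ₑ ^ 2 ≤ R ^ 2 * N := by
    intro v hv A hA hAQ
    refine (hT (openQ f) (fun φ hφ i => hu.2.2 φ
      (hφ.mono (openQ_subset_interior hf.continuousOn)) i) v A hA hAQ).trans ?_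
    gcongr
  obtain ⟨a, ha⟩ := hc₀ w hw hwi (R ^ 2 * N) fun v hv A hA hAC => hT' v (by
    rw [enorm_eq_nnnorm]
    exact ENNReal.coe_le_coe.2 (NNReal.coe_le_coe.1 (hv.trans hRd))) A hA
    fun x hx t ht => hf.openCube_subset (hAC x hx t ht)
  have horth := lintegral_sq_le_of_integral_inner_eq_zero hu.1
    (hf.memLp_of_continuous hM (continuous_const (y := a))) (by
      simp only [RCLike.inner_apply, conj_trivial]
      rw [integral_const_mul, h0, mul_zero])
  refine horth.trans ?_
  rw [lintegral_Q_eq hf (fun _ => a) hwu]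
  refine (lintegral_openQ_le (fun y hy => (hf.bounds y hy).2) ha
    (c := 2 * (R ^ 2 * N) + 2 * (c₀ * (R ^ 2 * N))) fun σ h hh1 hh2 => ?_).trans ?_
  · have hz : ∀ x ∈ slabPiece f σ h, horiz x + 0 ∈ openCube d := fun x hx => by
      simpa using hx.1.1.1
    refine (lintegral_le_of_translate (w := fun x => w x - a) (D := openCube (d + 1))
      (isOpen_slabPiece hf.continuousOn σ h).measurableSet isOpen_openCube.measurableSet
      (hw.sub stronglyMeasurable_const) (v := downVec 0 h) (T := R ^ 2 * N)
      (fun x hx => add_downVec_mem_openCube hx (hz x hx)) ?_).trans (by gcongr)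
    -- The constant `a` cancels in the difference, so the estimate for `w` applies.
    simp only [sub_sub_sub_cancel_right]
    exact hT' _ (enorm_downVec_le (by linarith) (by rw [norm_zero]; linarith)) _
      (isOpen_slabPiece hf.continuousOn σ h) fun x hx t ht =>
        add_smul_downVec_mem_openQ hf.lip hx (hz x hx) (by rw [norm_zero]; linarith) ht
  · rw [← hm]
    push_cast
    refine le_of_eq ?_
    ring

/-- The moments `∫ x_j u_i` form a symmetric matrix by `h1`, and its contraction with the skew `S`
vanishes. -/
lemma integral_inner_rigidMap_eq_zero (hf : IsProfile L M f) (hM : 1 < M)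
    {u : E (d + 1) → E (d + 1)} (hu : MemLp u 2 (volume.restrict (Q f)))
    (h0 : ∫ x in Q f, u x = 0)
    (h1 : ∀ i j, ∫ x in Q f, (x i * u x j - x j * u x i) = 0) {a : E (d + 1)}
    {S : Fin (d + 1) → Fin (d + 1) → ℝ} (hS : ∀ i j, S i j = -S j i) :
    ∫ x in Q f, inner ℝ (u x) (rigidMap a S x) = 0 := by
  have hfin : IsFiniteMeasure (volume.restrict (Q f)) := by
    rw [← Measure.restrict_congr_set (openQ_ae_eq hf.continuousOn)]
    exact ⟨by simpa using hf.volume_lt_top hM⟩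
  have hui : Integrable u (volume.restrict (Q f)) := hu.integrable (by norm_num)
  have hc : ∀ i j, Integrable (fun x => x j * u x i) (volume.restrict (Q f)) := fun i j =>
    (hf.memLp_of_continuous hM (r := fun x : E (d + 1) => x j) (by fun_prop)).integrable_mul
      (memLp_coord hu i)
  have h2 : ∀ x, inner ℝ (u x) (rigidMap a S x) =
      inner ℝ a (u x) + ∑ i, ∑ j, S i j * (x j * u x i) := fun x => by
    rw [rigidMap, inner_add_right, real_inner_comm]
    congr 1
    rw [PiLp.inner_apply]
    simp [Finset.sum_mul, mul_assoc]
  have hc2 : ∀ i, Integrable (fun x => ∑ j, S i j * (x j * u x i)) (volume.restrict (Q f)) :=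
    fun i => integrable_finsetSum _ fun j _ => (hc i j).const_mul _
  have h3 : ∑ i, ∑ j, S i j * ∫ x in Q f, x j * u x i = 0 := by
    have h4 : ∑ i, ∑ j, S i j * ∫ x in Q f, x j * u x i =
        -∑ i, ∑ j, S i j * ∫ x in Q f, x j * u x i := by
      conv_rhs => rw [Finset.sum_comm]
      simp only [← Finset.sum_neg_distrib]
      refine Finset.sum_congr rfl fun i _ => Finset.sum_congr rfl fun j _ => ?_
      have h5 := h1 i j
      rw [integral_sub (hc j i) (hc i j), sub_eq_zero] at h5
      rw [hS i j, h5]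
      ring
    linarith
  simp only [h2]
  rw [integral_add (hui.const_inner a) (integrable_finsetSum _ fun i _ => hc2 i),
    integral_inner hui, h0, inner_zero_right, zero_add,
    integral_finsetSum _ fun i _ => hc2 i, ← h3]
  refine Finset.sum_congr rfl fun i _ => ?_
  rw [integral_finsetSum _ fun j _ => (hc i j).const_mul _]
  simp only [integral_const_mul]

/-- The Korn inequality for fields orthogonal to the rigid motions. -/
lemma korn_orthogonal (d : ℕ) (L : ℝ≥0) (M : ℝ) (hM : 1 < M) : ∃ c : ℝ≥0,
    ∀ f : E d → ℝ, IsProfile L M f →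
      ∀ (u : E (d + 1) → E (d + 1)) (G : Fin (d + 1) → E (d + 1) → E (d + 1)),
      IsH1Vec (Q f) u G → ∫ x in Q f, u x = 0 →
      (∀ i j, ∫ x in Q f, (x i * u x j - x j * u x i) = 0) →
      ∫⁻ x in Q f, ‖u x‖ₑ ^ 2 ≤ c * ∫⁻ x in Q f, ‖symGrad G x‖ₑ ^ 2 := by
  obtain ⟨c₀, hc₀⟩ := exists_rigidMap_approx (d + 1)
  -- Here `L δ ≤ 1 / 2` is needed, since the lowest slab descends by `1 / 2` only.
  set δ : ℝ := 1 / (2 * L + 3) with hδ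
  have hL := L.coe_nonneg
  have hδp : 0 < δ := by positivity
  have hδ3 : δ ≤ 1 / 3 := one_div_le_one_div_of_le (by norm_num) (by linarith)
  have hLδ : L * δ ≤ 1 / 2 := by
    rw [hδ, mul_one_div, div_le_div_iff₀ (by positivity) (by positivity)]
    linarith
  set R : ℝ≥0 := (M + 2).toNNReal + (d + 1 : ℕ) with hR
  have hRM : M + 2 ≤ R := by
    rw [hR]; push_cast
    linarith [Real.le_coe_toNNReal (M + 2)]
  have hRd : ((d + 1 : ℕ) : ℝ) ≤ R := by
    rw [hR]; push_cast
    linarith [(M + 2).toNNReal.coe_nonneg]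
  set m : ℕ := Fintype.card ((Fin d → Bool) × Fin ⌈2 * M⌉₊) with hm
  set c : ℝ≥0∞ := (c₀ + m * (‖δ⁻¹‖ₑ ^ 2 * (4 * d + 1) * (2 + 2 * (R ^ 2 * c₀)))) * R ^ 4 with hc
  have hct : c ≠ ⊤ := by finiteness
  refine ⟨c.toNNReal, fun f hf u G hu h0 h1 => ?_⟩
  rw [ENNReal.coe_toNNReal hct]
  obtain ⟨hu2, U, hU, hUi, -, hUu, hT⟩ := hf.exists_vector_extension hM hu
  set N := ∫⁻ x in Q f, ‖symGrad G x‖ₑ ^ 2 with hN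
  have hT' : ∀ v, ‖v‖ₑ ≤ R → ∀ A, IsOpen A → (∀ x ∈ A, ∀ t ∈ Set.Icc (0 : ℝ) 1,
      x + t • v ∈ openQ f) →
      ∫⁻ x in A, ‖(inner ℝ v (U (x + v)) - inner ℝ v (U x) : ℝ)‖ₑ ^ 2 ≤ R ^ 4 * N := by
    intro v hv A hA hAQ
    refine (hT (openQ f) (fun φ hφ i j => (hu i).2.2 φ
      (hφ.mono (openQ_subset_interior hf.continuousOn)) j) v A hA hAQ).trans ?_
    gcongr
  obtain ⟨a, S, hS, ha⟩ := hc₀ U hU hUi (R ^ 4 * N) fun v hv A hA hAC => hT' v (by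
    rw [enorm_eq_nnnorm]
    exact ENNReal.coe_le_coe.2 (NNReal.coe_le_coe.1 (hv.trans hRd))) A hA
    fun x hx t ht => hf.openCube_subset (hAC x hx t ht)
  refine (lintegral_sq_le_of_integral_inner_eq_zero hu2
    (hf.memLp_of_continuous hM (continuous_rigidMap a S))
    (integral_inner_rigidMap_eq_zero hf hM hu2 h0 h1 hS)).trans ?_
  rw [lintegral_Q_eq hf (rigidMap a S) hUu]
  refine (lintegral_openQ_le (fun y hy => (hf.bounds y hy).2) ha
    (c := ‖δ⁻¹‖ₑ ^ 2 * (4 * d + 1) * (2 * (R ^ 4 * N) + 2 * (R ^ 2 * (c₀ * (R ^ 4 * N)))))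
    fun σ h hh1 hh2 => ?_).trans ?_
  · have hA := isOpen_slabPiece hf.continuousOn σ h
    have hZ : ∀ z ∈ insert (0 : E d)
        (Set.range fun j => EuclideanSpace.single j (sectorStep δ σ j)),
        ‖z‖ ≤ δ ∧ ∀ x ∈ slabPiece f σ h, horiz x + z ∈ openCube d := by
      rintro z (rfl | ⟨j, rfl⟩)
      · exact ⟨by simpa using hδp.le, fun x hx => by simpa using hx.1.1.1⟩
      · exact ⟨by simp [abs_sectorStep hδp],
          fun x hx => horiz_add_single_mem_openCube hδp hδ3 hx.1.1.1 hx.1.2 j⟩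
    refine (lintegral_le_of_downVec (U := fun x => U x - rigidMap a S x) (D := openCube (d + 1))
      (T := R ^ 4 * N) (R := R) hA.measurableSet isOpen_openCube.measurableSet
      (hU.sub (continuous_rigidMap a S).stronglyMeasurable) hδp (h := h) (by linarith)
      (by linarith) (fun j => abs_sectorStep hδp σ j) rfl
      (fun z hz x hx => add_downVec_mem_openCube hx ((hZ z hz).2 x hx))
      (fun z hz => ?_)).trans (by gcongr)
    -- The rigid motion drops out of the longitudinal differences, so the bound for `U` holds for `U
    -- - rigidMap a S`.
    simp only [inner_sub_right, inner_rigidMap_add hS, sub_sub_sub_cancel_right]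
    exact hT' _ (enorm_downVec_le (by linarith) (by linarith [(hZ z hz).1])) _ hA
      fun x hx t ht => add_smul_downVec_mem_openQ hf.lip hx ((hZ z hz).2 x hx)
        (((mul_le_mul_of_nonneg_left (hZ z hz).1 hL).trans hLδ).trans hh1) ht
  · rw [← hm]
    refine le_of_eq ?_
    ring

lemma eLpNorm_two_le_of_lintegral_sq_le {α F F' : Type*} [MeasurableSpace α]
    [NormedAddCommGroup F] [NormedAddCommGroup F'] {μ : Measure α} {u : α → F} {g : α → F'}
    {c C : ℝ≥0} (hcC : c + 1 ≤ C)
    (h : ∫⁻ x, ‖u x‖ₑ ^ 2 ∂μ ≤ c * ∫⁻ x, ‖g x‖ₑ ^ 2 ∂μ) :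
    eLpNorm u 2 μ ≤ C * eLpNorm g 2 μ := by
  rw [← ENNReal.pow_le_pow_left_iff two_ne_zero, mul_pow, sq_eLpNorm_two, sq_eLpNorm_two]
  refine h.trans ?_
  gcongr
  have : c ≤ C ^ 2 := by nlinarith [c.coe_nonneg, zero_le (a := c)]
  exact_mod_cast this

end Main

end PoincareKorn

theorem propositionB1 (d : ℕ) (L : ℝ≥0) (M : ℝ) (hL : 0 < L) (hM : 1 < M) :
    ∃ C : ℝ≥0, 0 < C ∧
      ∀ f : PoincareKorn.E d → ℝ,
        LipschitzOnWith L f (PoincareKorn.openCube d) →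
        (∀ y ∈ PoincareKorn.openCube d, 1 ≤ f y ∧ f y ≤ M) →
        -- (i) Poincaré inequality, zero trace on the base
        (∀ (u : PoincareKorn.E (d + 1) → ℝ) (g : PoincareKorn.E (d + 1) → PoincareKorn.E (d + 1)),
          PoincareKorn.IsH1 (PoincareKorn.Q f) u g →
          PoincareKorn.HasBaseTrace f u g 0 →
          eLpNorm u 2 (volume.restrict (PoincareKorn.Q f)) ≤
            C * eLpNorm g 2 (volume.restrict (PoincareKorn.Q f))) ∧
        -- (ii) Poincaré inequality, zero mean
        (∀ (u : PoincareKorn.E (d + 1) → ℝ) (g : PoincareKorn.E (d + 1) → PoincareKorn.E (d + 1)),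
          PoincareKorn.IsH1 (PoincareKorn.Q f) u g →
          ∫ x in PoincareKorn.Q f, u x = 0 →
          eLpNorm u 2 (volume.restrict (PoincareKorn.Q f)) ≤
            C * eLpNorm g 2 (volume.restrict (PoincareKorn.Q f))) ∧
        -- (iii) Poincaré–Korn inequality, zero trace on the base
        (∀ (u : PoincareKorn.E (d + 1) → PoincareKorn.E (d + 1))
            (G : Fin (d + 1) → PoincareKorn.E (d + 1) → PoincareKorn.E (d + 1)),
          PoincareKorn.IsH1Vec (PoincareKorn.Q f) u G →
          (∀ i, PoincareKorn.HasBaseTrace f (fun x => u x i) (G i) 0) →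
          eLpNorm u 2 (volume.restrict (PoincareKorn.Q f)) ≤
            C * eLpNorm (PoincareKorn.symGrad G) 2 (volume.restrict (PoincareKorn.Q f))) ∧
        -- (iv) Poincaré–Korn inequality, orthogonality to the rigid motions
        (∀ (u : PoincareKorn.E (d + 1) → PoincareKorn.E (d + 1))
            (G : Fin (d + 1) → PoincareKorn.E (d + 1) → PoincareKorn.E (d + 1)),
          PoincareKorn.IsH1Vec (PoincareKorn.Q f) u G →
          ∫ x in PoincareKorn.Q f, u x = 0 →
          (∀ i j, ∫ x in PoincareKorn.Q f, (x i * u x j - x j * u x i) = 0) →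
          eLpNorm u 2 (volume.restrict (PoincareKorn.Q f)) ≤
            C * eLpNorm (PoincareKorn.symGrad G) 2 (volume.restrict (PoincareKorn.Q f))) := by
  obtain ⟨c₁, h₁⟩ := PoincareKorn.poincare_zero_trace d L M hM
  obtain ⟨c₂, h₂⟩ := PoincareKorn.poincare_zero_mean d L M hM
  obtain ⟨c₃, h₃⟩ := PoincareKorn.korn_zero_trace d L M hM
  obtain ⟨c₄, h₄⟩ := PoincareKorn.korn_orthogonal d L M hM
  have p₁ := c₁.coe_nonneg
  have p₂ := c₂.coe_nonneg
  have p₃ := c₃.coe_nonneg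
  have p₄ := c₄.coe_nonneg
  -- The summand `1` gives positivity and `C ≥ 1`, so that each `cᵢ ≤ C ≤ C²` without square roots.
  refine ⟨c₁ + c₂ + c₃ + c₄ + 1, by positivity, fun f hL' hf' => ?_⟩
  have hf : PoincareKorn.IsProfile L M f := ⟨hL', hf'⟩
  refine ⟨fun u g hu h => ?_, fun u g hu h => ?_, fun u G hu h => ?_, fun u G hu h h' => ?_⟩
  · refine PoincareKorn.eLpNorm_two_le_of_lintegral_sq_le ?_ (h₁ f hf u g hu h)
    rw [← NNReal.coe_le_coe]; push_cast; linarith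
  · refine PoincareKorn.eLpNorm_two_le_of_lintegral_sq_le ?_ (h₂ f hf u g hu h)
    rw [← NNReal.coe_le_coe]; push_cast; linarith
  · refine PoincareKorn.eLpNorm_two_le_of_lintegral_sq_le ?_ (h₃ f hf u G hu h)
    rw [← NNReal.coe_le_coe]; push_cast; linarith
  · refine PoincareKorn.eLpNorm_two_le_of_lintegral_sq_le ?_ (h₄ f hf u G hu h h')
    rw [← NNReal.coe_le_coe]; push_cast; linarith
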